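/- **Setting.** Let $\mathcal A,\mathcal B,\mathcal C$ be unital $C^*$-algebras. Let $\mathbf E$ be an $\mathcal A$-$\mathcal B$ correspondence, i.e. a (right) Hilbert $C^*$-module over $\mathcal B$, with $\mathcal B$-valued inner product $\langle\cdot|\cdot\rangle$ linear in the second variable, together with a $*$-homomorphism from $\mathcal A$ into the adjointable operators on $\mathbf E$. Let $\mathbf G$ be a Hilbert $C^*$-module over $\mathcal C$, and let $(X,\mu)$ be a finite measure space. Let $(F_k)_k$ be a finite or infinite sequence of functions $X\to\mathbf E$ which are (strongly) measurable with $x\mapsto\langle F_k(x)|F_k(x)\rangle$ Bochner integrable, and which satisfy $$\int_X F_k(x)\,\langle F_l(x)|e\rangle\,d\mu(x)=\delta_{kl}\,e\qquad(e\in\mathbf E).$$ Let $(\phi_k)_k$ be a sequence in $\mathbf G$ with the same index set and $g=\sum_k\phi_k\langle\phi_k|g\rangle$ in norm for all $g\in\mathbf G$. Let $\mathcal B\otimes\mathcal C$ be the minimal (spatial) tensor product and $\mathbf H=\mathbf E\otimes\mathbf G$ the exterior tensor product, a Hilbert $C^*$-module over $\mathcal B\otimes\mathcal C$ with $\langle e\otimes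 g|e'\otimes g'\rangle=\langle e|e'\rangle\otimes\langle g|g'\rangle$ and left action $a(e\otimes g)=ae\otimes g$ of $\mathcal A$. Assume that for every $x\in X$ and every $a\in\mathcal A$ with $aa^*=1$ the series $$|x,a\rangle=\sum_k aF_k(x)\otimes\phi_k$$ of the module vector coherent state (MVCS) converges in norm in $\mathbf H$ (as a sequence of partial sums). **Claim.** The series then converges for every $x\in X$ and every $a\in\mathcal A$, and there is exactly one kernel $K:X\times X\to\mathcal L(\mathcal A,\mathcal B\otimes\mathcal C)$ with values in the bounded linear maps such that $$K(x,y)[a^*a']=\langle x,a\,|\,y,a'\rangle_{\mathbf H}\qquad(x,y\in X,\ a,a'\in\mathcal A).$$ If moreover $\langle\phi_k|\phi_l\rangle=0$ for $k\ne l$, then $K(x,y)[a^*a']=\sum_k\langle aF_k(x)\otimes\phi_k\,|\,a'F_k(y)\otimes\phi_k\rangle$. Furthermore: 1. $K$ is a completely positive kernel: $\sum_{i,j=1}^n d_i^*\,K(x_i,x_j)[a_i^*a_j]\,d_j\ge 0$ for all $n$, $x_i\in X$, $a_i\in\mathcal A$, $d_i\in\mathcal B\otimes\mathcal C$. 2.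 The formula is a Kolmogorov decomposition of $K$: with the $\mathcal A$-$(\mathcal B\otimes\mathcal C)$ correspondence $\mathbf H$ and the map $x\mapsto k_x=|x,1\rangle$ one has $|x,a\rangle=a\,k_x$ and $K(x,y)[a]=\langle k_x\,|\,a\,k_y\rangle$ for all $x,y\in X$, $a\in\mathcal A$. 3. $K$ has the reproducing property: for all $x,z\in X$, all $a,a'\in\mathcal A$, and all $b\in\mathcal A$ with $bb^*=1$, $$K(x,z)[a^*a']=\int_X K(x,y)[a^*b]\;K(y,z)[b^*a']\,d\mu(y),$$ and in particular $K(x,z)[a']=\int_X K(x,y)[1]\,K(y,z)[a']\,d\mu(y)$. The integrals exist as Pettis (weak) integrals in $\mathcal B\otimes\mathcal C$. -/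

import Mathlib

open scoped ComplexOrder InnerProductSpace TensorProduct ENNReal Topology RightActions
open Filter MeasureTheory

noncomputable section

section HilbertCompletion

variable (V : Type*) [SeminormedAddCommGroup V] [InnerProductSpace ℂ V]

/-- The completion of an inner product space. -/
def HilbertCompletion : Type _ := UniformSpace.Completion V

instance : NormedAddCommGroup (HilbertCompletion V) :=
  inferInstanceAs (NormedAddCommGroup (UniformSpace.Completion V))
instance : InnerProductSpace ℂ (HilbertCompletion V) :=
  inferInstanceAs (InnerProductSpace ℂ (UniformSpace.Completion V))
instance : CompleteSpace (HilbertCompletion V) :=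
  inferInstanceAs (CompleteSpace (UniformSpace.Completion V))

end HilbertCompletion

/-- Right inner product modules over a `C*`-algebra `B`: the inner product `ip x y = ⟨x | y⟩` is
`B`-valued, linear in the second variable, `⟨x | y b⟩ = ⟨x | y⟩ b`, and the norm of `E` is
`‖⟨x | x⟩‖ ^ (1 / 2)`. The right action is written `x <• b`. Together with `[CompleteSpace E]` this
is a Hilbert `C*`-module; the module laws of the right action follow from the axioms. -/
class InnerProductModule (B E : Type*) [NonUnitalCStarAlgebra B] [PartialOrder B]
    [NormedAddCommGroup E] [NormedSpace ℂ E] [SMul Bᵐᵒᵖ E] where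
  ip : E → E → B
  ip_add_right : ∀ x y z, ip x (y + z) = ip x y + ip x z
  ip_smul_right : ∀ (c : ℂ) x y, ip x (c • y) = c • ip x y
  ip_op_smul_right : ∀ x y (b : B), ip x (y <• b) = ip x y * b
  star_ip : ∀ x y, star (ip x y) = ip y x
  ip_self_nonneg : ∀ x, 0 ≤ ip x x
  norm_sq_eq : ∀ x, ‖x‖ ^ 2 = ‖ip x x‖

namespace InnerProductModule

variable {B E : Type*} [NonUnitalCStarAlgebra B] [PartialOrder B]
  [NormedAddCommGroup E] [NormedSpace ℂ E] [SMul Bᵐᵒᵖ E] [InnerProductModule B E]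

theorem ip_add_left (x y z : E) : ip (B := B) (x + y) z = ip x z + ip y z := by
  rw [← star_ip, ip_add_right, star_add, star_ip, star_ip]

theorem ip_smul_left (c : ℂ) (x y : E) : ip (B := B) (c • x) y = star c • ip x y := by
  rw [← star_ip, ip_smul_right, star_smul, star_ip]

theorem ip_op_smul_left (x y : E) (b : B) : ip (B := B) (x <• b) y = star b * ip x y := by
  rw [← star_ip, ip_op_smul_right, star_mul, star_ip]

theorem ip_zero_right (x : E) : ip (B := B) x 0 = 0 := by
  simpa using ip_smul_right (B := B) 0 x 0

theorem ip_zero_left (x : E) : ip (B := B) 0 x = 0 := by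
  rw [← star_ip, ip_zero_right, star_zero]

theorem ip_sub_right (x y z : E) : ip (B := B) x (y - z) = ip x y - ip x z := by
  have := ip_smul_right (B := B) (-1) x z
  rw [sub_eq_add_neg, ip_add_right, ← neg_one_smul ℂ z, this, neg_one_smul, sub_eq_add_neg]

theorem ext_ip {x y : E} (h : ∀ z, ip (B := B) z x = ip z y) : x = y := by
  have h1 : ip (B := B) (x - y) (x - y) = 0 := by rw [ip_sub_right, h, sub_self]
  have h2 : ‖x - y‖ ^ 2 = 0 := by rw [norm_sq_eq (B := B), h1, norm_zero]
  exact sub_eq_zero.1 (norm_eq_zero.1 (pow_eq_zero_iff two_ne_zero |>.1 h2))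

theorem add_op_smul (x y : E) (b : B) : (x + y) <• b = x <• b + y <• b :=
  ext_ip (B := B) fun z => by simp only [ip_op_smul_right, ip_add_right, add_mul]

theorem smul_op_smul (c : ℂ) (x : E) (b : B) : (c • x) <• b = c • (x <• b) :=
  ext_ip (B := B) fun z => by
    simp only [ip_op_smul_right, ip_smul_right, smul_mul_assoc]

theorem op_add_smul (x : E) (b b' : B) : x <• (b + b') = x <• b + x <• b' :=
  ext_ip (B := B) fun z => by simp only [ip_op_smul_right, ip_add_right, mul_add]

theorem op_smul_smul (c : ℂ) (x : E) (b : B) : x <• (c • b) = c • (x <• b) :=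
  ext_ip (B := B) fun z => by
    simp only [ip_op_smul_right, ip_smul_right, mul_smul_comm]

theorem op_mul_smul (x : E) (b b' : B) : x <• (b * b') = (x <• b) <• b' :=
  ext_ip (B := B) fun z => by simp only [ip_op_smul_right, mul_assoc]

end InnerProductModule

open InnerProductModule

/-- A `C*`-algebra as a Hilbert module over itself, `⟨x | y⟩ = x* y`. -/
instance instInnerProductModuleSelf (B : Type*) [CStarAlgebra B] [PartialOrder B]
    [StarOrderedRing B] : InnerProductModule B B where
  ip x y := star x * y
  ip_add_right x y z := mul_add _ _ _
  ip_smul_right c x y := mul_smul_comm _ _ _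
  ip_op_smul_right x y b := by simp [mul_assoc]
  star_ip x y := by simp
  ip_self_nonneg x := star_mul_self_nonneg x
  norm_sq_eq x := by rw [sq, CStarRing.norm_star_mul_self]

/-- A left action of `A` on the right inner product module `E`: a `*`-homomorphism from `A` into
the adjointable operators of `E`, which makes a Hilbert module `E` an `A`-`B` correspondence. -/
structure LeftAction (A B E : Type*) [CStarAlgebra A] [NonUnitalCStarAlgebra B] [PartialOrder B]
    [NormedAddCommGroup E] [NormedSpace ℂ E] [SMul Bᵐᵒᵖ E] [InnerProductModule B E] where
  hom : A →ₙₐ[ℂ] Module.End ℂ E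
  ip_hom_left : ∀ a x y, ip (B := B) (hom a x) y = ip x (hom (star a) y)

section Localization

variable {B : Type*} [CStarAlgebra B] [PartialOrder B] [StarOrderedRing B]

set_option linter.unusedVariables false in
/-- `E` with the semi-inner product `ω (⟨x | y⟩)`, for a positive functional `ω` on `B`. -/
def PreLoc (ω : B →ₚ[ℂ] ℂ) (E : Type*) : Type _ := E

variable (ω : B →ₚ[ℂ] ℂ) (E : Type*) [NormedAddCommGroup E] [NormedSpace ℂ E] [SMul Bᵐᵒᵖ E]
  [InnerProductModule B E]

instance : AddCommGroup (PreLoc ω E) := inferInstanceAs (AddCommGroup E)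
instance : Module ℂ (PreLoc ω E) := inferInstanceAs (Module ℂ E)

/-- The identity map. -/
def toPreLoc : E ≃ₗ[ℂ] PreLoc ω E := LinearEquiv.refl ℂ E

/-- The semi-inner product `ω (⟨x | y⟩)`. -/
abbrev preLocCore : PreInnerProductSpace.Core ℂ (PreLoc ω E) where
  inner x y := ω (ip ((toPreLoc ω E).symm x) ((toPreLoc ω E).symm y))
  conj_inner_symm x y := by
    rw [starRingEnd_apply, ← map_star, star_ip]
  re_inner_nonneg x := RCLike.nonneg_iff.mp (ω.map_nonneg (ip_self_nonneg _)) |>.1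
  add_left x y z := by rw [map_add, ip_add_left, map_add]
  smul_left x y c := by rw [map_smul, ip_smul_left, map_smul]; rfl

instance : SeminormedAddCommGroup (PreLoc ω E) :=
  InnerProductSpace.Core.toSeminormedAddCommGroup (c := preLocCore ω E)
instance : InnerProductSpace ℂ (PreLoc ω E) := InnerProductSpace.ofCore (preLocCore ω E)

/-- The Hilbert space completion of `E` for the semi-inner product `ω (⟨x | y⟩)`. For `E = B` this
is the Gelfand-Naimark-Segal space `H_ω`, and in general it is the interior tensor product of `E`
with `H_ω` over `B`. -/
abbrev Loc := HilbertCompletion (PreLoc ω E)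

variable {E}

/-- The class of `x` in the completion. -/
def toLoc (x : E) : Loc ω E :=
  ((toPreLoc ω E x : PreLoc ω E) : UniformSpace.Completion (PreLoc ω E))

theorem toLoc_add (x y : E) : toLoc ω (x + y) = toLoc ω x + toLoc ω y := by
  rw [toLoc, map_add, UniformSpace.Completion.coe_add]; rfl

theorem toLoc_smul (c : ℂ) (x : E) : toLoc ω (c • x) = c • toLoc ω x := by
  rw [toLoc, map_smul, UniformSpace.Completion.coe_smul]; rfl

theorem denseRange_toLoc : DenseRange (toLoc ω : E → Loc ω E) :=
  UniformSpace.Completion.denseRange_coe (α := PreLoc ω E)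

theorem inner_toLoc (x y : E) : inner ℂ (toLoc ω x) (toLoc ω y) = ω (ip x y) :=
  UniformSpace.Completion.inner_coe (𝕜 := ℂ) (toPreLoc ω E x) (toPreLoc ω E y)

theorem preLoc_inner (x y : E) :
    inner ℂ (toPreLoc ω E x) (toPreLoc ω E y) = ω (ip x y) := rfl

theorem preLoc_norm_sq (x : E) : ((‖toPreLoc ω E x‖ ^ 2 : ℝ) : ℂ) = ω (ip x x) := by
  rw [← preLoc_inner, inner_self_eq_norm_sq_to_K]; simp

theorem norm_sq_toLoc (x : E) : ((‖toLoc ω x‖ ^ 2 : ℝ) : ℂ) = ω (ip x x) := by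
  rw [← preLoc_norm_sq]
  exact congrArg (fun r : ℝ => ((r ^ 2 : ℝ) : ℂ)) (UniformSpace.Completion.norm_coe _)

variable {F : Type*} [NormedAddCommGroup F] [NormedSpace ℂ F] [SMul Bᵐᵒᵖ F]
  [InnerProductModule B F]

/-- The operator on the completions that is induced by a bounded map. -/
def locMap (T : E →ₗ[ℂ] F) (M : ℝ) (hM : 0 ≤ M)
    (hT : ∀ x, ω (ip (T x) (T x)) ≤ ω ((M ^ 2 : ℝ) • ip x x)) : Loc ω E →L[ℂ] Loc ω F :=
  (LinearMap.mkContinuous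
    ((toPreLoc ω F).toLinearMap ∘ₗ T ∘ₗ (toPreLoc ω E).symm.toLinearMap) M fun x => by
      obtain ⟨x, rfl⟩ := (toPreLoc ω E).surjective x
      have h := hT x
      rw [← Complex.coe_smul, map_smul, ← preLoc_norm_sq, ← preLoc_norm_sq, smul_eq_mul,
        ← Complex.ofReal_mul, Complex.real_le_real, ← mul_pow] at h
      exact (sq_le_sq₀ (norm_nonneg _) (by positivity)).1 h).completion

theorem locMap_coe (T : E →ₗ[ℂ] F) (M : ℝ) (hM : 0 ≤ M)
    (hT : ∀ x, ω (ip (T x) (T x)) ≤ ω ((M ^ 2 : ℝ) • ip x x)) (x : E) :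
    locMap ω T M hM hT (toLoc ω x) = toLoc ω (T x) := by
  exact ContinuousLinearMap.completion_apply_coe _ (toPreLoc ω E x)

theorem norm_locMap_le (T : E →ₗ[ℂ] F) (M : ℝ) (hM : 0 ≤ M)
    (hT : ∀ x, ω (ip (T x) (T x)) ≤ ω ((M ^ 2 : ℝ) • ip x x)) : ‖locMap ω T M hM hT‖ ≤ M := by
  refine ContinuousLinearMap.opNorm_le_bound _ hM fun x => ?_
  refine (denseRange_toLoc ω).induction_on x (isClosed_le (ContinuousLinearMap.continuous _).norm
    (continuous_const.mul continuous_norm)) fun x => ?_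
  have h := hT x
  rw [← Complex.coe_smul, map_smul, ← norm_sq_toLoc, ← norm_sq_toLoc, smul_eq_mul,
    ← Complex.ofReal_mul, Complex.real_le_real, ← mul_pow] at h
  rw [locMap_coe]
  exact (sq_le_sq₀ (norm_nonneg _) (by positivity)).1 h

/-- `b ↦ e b`. -/
def ketₗ (e : E) : B →ₗ[ℂ] E where
  toFun b := e <• b
  map_add' b b' := op_add_smul e b b'
  map_smul' c b := op_smul_smul c e b

/-- The operator `b ↦ e b`; on `E = B` these operators form the Gelfand-Naimark-Segal
representation of `B`. -/
def ket (e : E) : Loc ω B →L[ℂ] Loc ω E :=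
  locMap ω (ketₗ e) ‖e‖ (norm_nonneg e) fun b => by
    refine OrderHomClass.mono ω ?_
    change ip (e <• b) (e <• b) ≤ ‖e‖ ^ 2 • (star b * b)
    rw [ip_op_smul_left, ip_op_smul_right, norm_sq_eq (B := B), ← mul_assoc]
    have : IsSelfAdjoint (ip (B := B) e e) := star_ip e e
    simpa [smul_mul_assoc] using
      CStarAlgebra.star_left_conjugate_le_norm_smul (a := b) (b := ip (B := B) e e)

theorem ket_coe (e : E) (b : B) :
    ket ω e (toLoc ω b) = toLoc ω (e <• b) := by
  rw [ket, locMap_coe]; rfl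

theorem norm_ket_le (e : E) : ‖ket ω e‖ ≤ ‖e‖ := norm_locMap_le _ _ _ _ _

theorem loc_ext {T S : Loc ω E →L[ℂ] Loc ω F}
    (h : ∀ x : E, T (toLoc ω x) = S (toLoc ω x)) : T = S := by
  ext x
  exact (denseRange_toLoc ω).induction_on x (isClosed_eq T.continuous S.continuous) h

theorem ket_add (e e' : E) : ket ω (e + e') = ket ω e + ket ω e' :=
  loc_ext ω fun b => by
    rw [add_apply, ket_coe, ket_coe, ket_coe, add_op_smul, toLoc_add]

theorem ket_smul (c : ℂ) (e : E) : ket ω (c • e) = c • ket ω e :=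
  loc_ext ω fun b => by
    rw [smul_apply, ket_coe, ket_coe, smul_op_smul, toLoc_smul]

theorem ket_comp_ket (e : E) (b : B) : ket ω e ∘L ket ω b = ket ω (e <• b) :=
  loc_ext ω fun b' => by
    rw [ContinuousLinearMap.comp_apply, ket_coe, ket_coe, ket_coe, ← op_mul_smul]; rfl

theorem adjoint_ket_comp_ket (e e' : E) :
    (ket ω e).adjoint ∘L ket ω e' = ket ω (ip (B := B) e e') := by
  refine loc_ext ω fun b => ?_
  refine ext_inner_left ℂ fun v => ?_
  rw [ContinuousLinearMap.comp_apply, ContinuousLinearMap.adjoint_inner_right]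
  refine (denseRange_toLoc ω).induction_on v (isClosed_eq
    ((ket ω e).continuous.inner continuous_const) (continuous_id.inner continuous_const)) fun v => ?_
  rw [ket_coe, ket_coe, ket_coe, inner_toLoc, inner_toLoc, ip_op_smul_left, ip_op_smul_right]
  rfl

variable {A : Type*} [CStarAlgebra A]

theorem LeftAction.ip_hom_le {B E : Type*} [CStarAlgebra B] [PartialOrder B]
    [StarOrderedRing B] [NormedAddCommGroup E] [NormedSpace ℂ E] [SMul Bᵐᵒᵖ E]
    [InnerProductModule B E] (L : LeftAction A B E) (a : A) (x : E) :
    ip (B := B) (L.hom a x) (L.hom a x) ≤ (‖a‖ ^ 2 : ℝ) • ip x x := by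
  let _ := CStarAlgebra.spectralOrder A
  have := CStarAlgebra.spectralOrderedRing A
  have hmul : ∀ (a b : A) (y : E), L.hom (a * b) y = L.hom a (L.hom b y) := fun a b y => by
    rw [map_mul]; rfl
  have h1 : ip (B := B) (L.hom 1 x) (L.hom 1 x) ≤ ip x x := by
    have h := ip_self_nonneg (B := B) (x - L.hom 1 x)
    have e1 : ip (B := B) x (L.hom 1 x) = ip (L.hom 1 x) (L.hom 1 x) := by
      rw [L.ip_hom_left, ← hmul, star_one, one_mul]
    have e2 : ip (B := B) (L.hom 1 x) x = ip (L.hom 1 x) (L.hom 1 x) := by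
      rw [← star_ip, e1, star_ip]
    have e3 : ip (B := B) (x - L.hom 1 x) (x - L.hom 1 x)
        = ip x x - ip (L.hom 1 x) (L.hom 1 x) := by
      rw [ip_sub_right, ← star_ip (B := B) x, ip_sub_right, star_sub, star_ip, star_ip,
        ← star_ip (B := B) (L.hom 1 x), ip_sub_right, star_sub, star_ip, star_ip, e1, e2]
      abel
    rw [e3] at h
    exact sub_nonneg.1 h
  obtain ⟨c, hc⟩ : ∃ c : A, (‖a‖ ^ 2 : ℝ) • (1 : A) - star a * a = star c * c := by
    have h : star a * a ≤ (‖a‖ ^ 2 : ℝ) • (1 : A) := by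
      have := CStarAlgebra.star_mul_le_algebraMap_norm_sq (a := a)
      rwa [Algebra.algebraMap_eq_smul_one] at this
    obtain ⟨c, hc⟩ := CStarAlgebra.nonneg_iff_eq_star_mul_self.1 (sub_nonneg.2 h)
    exact ⟨c, hc⟩
  have h2 : 0 ≤ (‖a‖ ^ 2 : ℝ) • ip (B := B) (L.hom 1 x) (L.hom 1 x)
      - ip (L.hom a x) (L.hom a x) := by
    have h3 := ip_self_nonneg (B := B) (L.hom c x)
    rw [L.ip_hom_left, ← hmul, ← hc, map_sub, ← Complex.coe_smul, map_smul,
      LinearMap.sub_apply, ip_sub_right, LinearMap.smul_apply, ip_smul_right, Complex.coe_smul,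
      hmul, ← L.ip_hom_left] at h3
    have e1 : ip (B := B) x (L.hom 1 x) = ip (L.hom 1 x) (L.hom 1 x) := by
      rw [L.ip_hom_left, ← hmul, star_one, one_mul]
    rwa [e1] at h3
  exact (sub_nonneg.1 h2).trans (smul_le_smul_of_nonneg_left h1 (by positivity))

/-- The operator `x ↦ a x`. -/
def act (L : LeftAction A B E) (a : A) : Loc ω E →L[ℂ] Loc ω E :=
  locMap ω (L.hom a) ‖a‖ (norm_nonneg a) fun x => OrderHomClass.mono ω (L.ip_hom_le a x)

theorem act_coe (L : LeftAction A B E) (a : A) (x : E) :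
    act ω L a (toLoc ω x) = toLoc ω (L.hom a x) :=
  locMap_coe _ _ _ _ _ _

theorem norm_act_le (L : LeftAction A B E) (a : A) : ‖act ω L a‖ ≤ ‖a‖ :=
  norm_locMap_le _ _ _ _ _

theorem adjoint_act (L : LeftAction A B E) (a : A) :
    (act ω L a).adjoint = act ω L (star a) := by
  refine loc_ext ω fun x => ?_
  refine ext_inner_left ℂ fun v => ?_
  rw [ContinuousLinearMap.adjoint_inner_right]
  refine (denseRange_toLoc ω).induction_on v (isClosed_eq
    ((act ω L a).continuous.inner continuous_const) (continuous_id.inner continuous_const)) fun v => ?_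
  rw [act_coe, act_coe, inner_toLoc, inner_toLoc, L.ip_hom_left]

set_option linter.unusedSectionVars false in
theorem hom_op_smul (L : LeftAction A B E) (a : A) (e : E) (b : B) :
    L.hom a (e <• b) = L.hom a e <• b :=
  ext_ip (B := B) fun z => by
    have h : ∀ w, ip (B := B) z (L.hom a w) = ip (L.hom (star a) z) w := fun w => by
      rw [L.ip_hom_left, star_star]
    rw [h, ip_op_smul_right, ip_op_smul_right, h]

theorem act_comp_ket (L : LeftAction A B E) (a : A) (e : E) :
    act ω L a ∘L ket ω e = ket ω (L.hom a e) :=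
  loc_ext ω fun b => by
    rw [ContinuousLinearMap.comp_apply, ket_coe, ket_coe, act_coe, hom_op_smul]

theorem act_add (L : LeftAction A B E) (a a' : A) : act ω L (a + a') = act ω L a + act ω L a' :=
  loc_ext ω fun x => by
    rw [add_apply, act_coe, act_coe, act_coe, ← toLoc_add, map_add L.hom]; rfl

theorem act_smul (L : LeftAction A B E) (c : ℂ) (a : A) : act ω L (c • a) = c • act ω L a :=
  loc_ext ω fun x => by
    rw [smul_apply, act_coe, act_coe, ← toLoc_smul, map_smul L.hom]; rfl

theorem act_mul (L : LeftAction A B E) (a a' : A) : act ω L (a * a') = act ω L a ∘L act ω L a' :=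
  loc_ext ω fun x => by
    rw [ContinuousLinearMap.comp_apply, act_coe, act_coe, act_coe, map_mul L.hom]; rfl

end Localization

/-! ### Bounded families of operators between Hilbert spaces -/

section BoundedFamilies

set_option linter.unusedSectionVars false

variable {I : Type*} (𝓗 𝓚 𝓛 : I → Type*)
  [∀ i, NormedAddCommGroup (𝓗 i)] [∀ i, InnerProductSpace ℂ (𝓗 i)] [∀ i, CompleteSpace (𝓗 i)]
  [∀ i, NormedAddCommGroup (𝓚 i)] [∀ i, InnerProductSpace ℂ (𝓚 i)] [∀ i, CompleteSpace (𝓚 i)]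
  [∀ i, NormedAddCommGroup (𝓛 i)] [∀ i, InnerProductSpace ℂ (𝓛 i)] [∀ i, CompleteSpace (𝓛 i)]

/-- The bounded families of operators `𝓗 i → 𝓚 i` with the supremum norm. -/
abbrev OpFamily := lp (fun i => 𝓗 i →L[ℂ] 𝓚 i) ∞

instance : NormedAddCommGroup (OpFamily 𝓗 𝓚) := lp.normedAddCommGroup
instance : AddCommGroup (OpFamily 𝓗 𝓚) := NormedAddCommGroup.toAddCommGroup
instance : SeminormedAddCommGroup (OpFamily 𝓗 𝓚) := NormedAddCommGroup.toSeminormedAddCommGroup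
instance : NormedSpace ℂ (OpFamily 𝓗 𝓚) := lp.instNormedSpace
instance : Module ℂ (OpFamily 𝓗 𝓚) := NormedSpace.toModule
instance : SMul ℂ (OpFamily 𝓗 𝓚) := inferInstance
instance : AddCommMonoid (OpFamily 𝓗 𝓚) := AddCommGroup.toAddCommMonoid
instance : TopologicalSpace (OpFamily 𝓗 𝓚) := inferInstance
instance : UniformSpace (OpFamily 𝓗 𝓚) := inferInstance
instance : ContinuousConstSMul ℂ (OpFamily 𝓗 𝓚) := inferInstance
instance : ContinuousAdd (OpFamily 𝓗 𝓚) := inferInstance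
instance : CompleteSpace (OpFamily 𝓗 𝓚) := inferInstance
instance : Norm (OpFamily 𝓗 𝓚) := inferInstance
instance : Add (OpFamily 𝓗 𝓚) := inferInstance
instance : NonUnitalCStarAlgebra (OpFamily 𝓗 𝓗) := inferInstance

variable {𝓗 𝓚 𝓛}

/-- A bounded family of operators. -/
def opMk (T : ∀ i, 𝓗 i →L[ℂ] 𝓚 i) (M : ℝ) (hT : ∀ i, ‖T i‖ ≤ M) : OpFamily 𝓗 𝓚 :=
  ⟨T, memℓp_infty ⟨M, by rintro _ ⟨i, rfl⟩; exact hT i⟩⟩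

theorem opFamily_norm_apply_le (T : OpFamily 𝓗 𝓚) (i : I) : ‖T i‖ ≤ ‖T‖ :=
  lp.norm_apply_le_norm ENNReal.top_ne_zero T i

theorem opFamily_norm_le {T : OpFamily 𝓗 𝓚} {M : ℝ} (hM : 0 ≤ M) (h : ∀ i, ‖T i‖ ≤ M) :
    ‖T‖ ≤ M := lp.norm_le_of_forall_le hM h

/-- Composition of families. -/
def opComp (S : OpFamily 𝓚 𝓛) (T : OpFamily 𝓗 𝓚) : OpFamily 𝓗 𝓛 :=
  opMk (fun i => S i ∘L T i) (‖S‖ * ‖T‖) fun i =>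
    (ContinuousLinearMap.opNorm_comp_le _ _).trans
      (mul_le_mul (opFamily_norm_apply_le S i) (opFamily_norm_apply_le T i) (norm_nonneg _)
        (norm_nonneg _))

/-- The family of the adjoints. -/
def opAdj (T : OpFamily 𝓗 𝓚) : OpFamily 𝓚 𝓗 :=
  opMk (fun i => (T i).adjoint) ‖T‖ fun i => by
    rw [LinearIsometryEquiv.norm_map]; exact opFamily_norm_apply_le T i

@[simp] theorem opComp_apply (S : OpFamily 𝓚 𝓛) (T : OpFamily 𝓗 𝓚) (i : I) :
    opComp S T i = S i ∘L T i := rfl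

@[simp] theorem opAdj_apply (T : OpFamily 𝓗 𝓚) (i : I) :
    opAdj T i = (T i).adjoint := rfl

theorem opFamily_ext {S T : OpFamily 𝓗 𝓚} (h : ∀ i, S i = T i) : S = T :=
  lp.ext (funext h)

theorem opFamily_norm_comp_le (S : OpFamily 𝓚 𝓛) (T : OpFamily 𝓗 𝓚) :
    ‖opComp S T‖ ≤ ‖S‖ * ‖T‖ :=
  opFamily_norm_le (by positivity) fun i => (ContinuousLinearMap.opNorm_comp_le _ _).trans
      (mul_le_mul (opFamily_norm_apply_le S i) (opFamily_norm_apply_le T i) (norm_nonneg _)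
        (norm_nonneg _))

theorem opComp_add (S : OpFamily 𝓚 𝓛) (T T' : OpFamily 𝓗 𝓚) :
    opComp S (T + T') = opComp S T + opComp S T' := opFamily_ext fun i => by simp

theorem opComp_smul (S : OpFamily 𝓚 𝓛) (c : ℂ) (T : OpFamily 𝓗 𝓚) :
    opComp S (c • T) = c • opComp S T := opFamily_ext fun i => by simp

theorem add_opComp (S S' : OpFamily 𝓚 𝓛) (T : OpFamily 𝓗 𝓚) :
    opComp (S + S') T = opComp S T + opComp S' T := opFamily_ext fun i => by simp

theorem smul_opComp (c : ℂ) (S : OpFamily 𝓚 𝓛) (T : OpFamily 𝓗 𝓚) :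
    opComp (c • S) T = c • opComp S T := opFamily_ext fun i => by simp

/-- Composition with a fixed family. -/
def opCompLeft (S : OpFamily 𝓚 𝓛) : OpFamily 𝓗 𝓚 →L[ℂ] OpFamily 𝓗 𝓛 :=
  LinearMap.mkContinuous
    { toFun := opComp S
      map_add' := opComp_add S
      map_smul' := opComp_smul S } ‖S‖ (opFamily_norm_comp_le S)

/-- Composition with a fixed family. -/
def opCompRight (T : OpFamily 𝓗 𝓚) : OpFamily 𝓚 𝓛 →L[ℂ] OpFamily 𝓗 𝓛 :=
  LinearMap.mkContinuous
    { toFun := fun S => opComp S T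
      map_add' := fun S S' => add_opComp S S' T
      map_smul' := fun c S => smul_opComp c S T } ‖T‖
    fun S => (opFamily_norm_comp_le S T).trans_eq (mul_comm _ _)

@[simp] theorem opCompLeft_apply (S : OpFamily 𝓚 𝓛) (T : OpFamily 𝓗 𝓚) :
    opCompLeft S T = opComp S T := rfl

@[simp] theorem opCompRight_apply (S : OpFamily 𝓚 𝓛) (T : OpFamily 𝓗 𝓚) :
    opCompRight T S = opComp S T := rfl

theorem opFamily_mul_eq_comp (S T : OpFamily 𝓗 𝓗) : S * T = opComp S T := rfl

theorem opFamily_star_eq_adj (S : OpFamily 𝓗 𝓗) : star S = opAdj S := rfl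

theorem opAdj_opComp (S : OpFamily 𝓚 𝓛) (T : OpFamily 𝓗 𝓚) :
    opAdj (opComp S T) = opComp (opAdj T) (opAdj S) :=
  opFamily_ext fun i => by
    rw [opAdj_apply, opComp_apply, opComp_apply, opAdj_apply, opAdj_apply,
      ContinuousLinearMap.adjoint_comp]

theorem opAdj_opAdj (T : OpFamily 𝓗 𝓚) : opAdj (opAdj T) = T :=
  opFamily_ext fun i => by
    rw [opAdj_apply, opAdj_apply, ContinuousLinearMap.adjoint_adjoint]

theorem opComp_assoc {𝓜 : I → Type*} [∀ i, NormedAddCommGroup (𝓜 i)]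
    [∀ i, InnerProductSpace ℂ (𝓜 i)] [∀ i, CompleteSpace (𝓜 i)]
    (R : OpFamily 𝓛 𝓜) (S : OpFamily 𝓚 𝓛) (T : OpFamily 𝓗 𝓚) :
    opComp (opComp R S) T = opComp R (opComp S T) := opFamily_ext fun _ => rfl

theorem opFamily_norm_adj_comp_self (T : OpFamily 𝓗 𝓚) : ‖opComp (opAdj T) T‖ = ‖T‖ ^ 2 := by
  have h : ∀ i, ‖T i‖ ^ 2 ≤ ‖opComp (opAdj T) T‖ := fun i => by
    rw [sq, ← ContinuousLinearMap.norm_adjoint_comp_self]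
    exact opFamily_norm_apply_le (opComp (opAdj T) T) i
  refine le_antisymm (opFamily_norm_le (by positivity) fun i => ?_) ?_
  · rw [opComp_apply, opAdj_apply, ContinuousLinearMap.norm_adjoint_comp_self, ← sq]
    exact pow_le_pow_left₀ (norm_nonneg _) (opFamily_norm_apply_le T i) 2
  · rw [← Real.le_sqrt (norm_nonneg _) (norm_nonneg _)]
    exact opFamily_norm_le (Real.sqrt_nonneg _) fun i => Real.le_sqrt_of_sq_le (h i)

theorem clm_exists_adjoint_comp_self {V W : Type*}
    [NormedAddCommGroup V] [InnerProductSpace ℂ V] [CompleteSpace V]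
    [NormedAddCommGroup W] [InnerProductSpace ℂ W] [CompleteSpace W] (T : V →L[ℂ] W) :
    ∃ S : V →L[ℂ] V, ‖S‖ ≤ ‖T‖ ∧ T.adjoint ∘L T = S.adjoint ∘L S := by
  have hp : 0 ≤ T.adjoint ∘L T := (ContinuousLinearMap.nonneg_iff_isPositive _).2
    (ContinuousLinearMap.isPositive_adjoint_comp_self T)
  have h1 : (CFC.sqrt (T.adjoint ∘L T)).adjoint = CFC.sqrt (T.adjoint ∘L T) :=
    (CFC.sqrt_nonneg (T.adjoint ∘L T)).isSelfAdjoint.star_eq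
  have h2 : CFC.sqrt (T.adjoint ∘L T) ∘L CFC.sqrt (T.adjoint ∘L T) = T.adjoint ∘L T :=
    CFC.sqrt_mul_sqrt_self _ hp
  refine ⟨CFC.sqrt (T.adjoint ∘L T), ?_, ?_⟩
  · rw [CFC.norm_sqrt _ hp, ContinuousLinearMap.norm_adjoint_comp_self,
      Real.sqrt_mul_self (norm_nonneg _)]
  · rw [h1, h2]

theorem opFamily_exists_adj_comp_self (T : OpFamily 𝓗 𝓚) :
    ∃ S : OpFamily 𝓗 𝓗, opComp (opAdj T) T = opComp (opAdj S) S := by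
  choose S hS h using fun i => clm_exists_adjoint_comp_self (T i)
  refine ⟨opMk S ‖T‖ fun i => (hS i).trans (opFamily_norm_apply_le T i), opFamily_ext fun i => ?_⟩
  rw [opComp_apply, opAdj_apply, h i]
  rfl

theorem clm_mem_closure_span {V W : Type*} [NormedAddCommGroup V] [NormedSpace ℂ V]
    [NormedAddCommGroup W] [NormedSpace ℂ W] (f : V →L[ℂ] W) (s : Set V) (N : Submodule ℂ W)
    (hN : IsClosed (N : Set W)) (h : ∀ v ∈ s, f v ∈ N) {v : V}
    (hv : v ∈ (Submodule.span ℂ s).topologicalClosure) : f v ∈ N := by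
  have : (Submodule.span ℂ s).topologicalClosure ≤ N.comap f.toLinearMap :=
    Submodule.topologicalClosure_minimal _ (Submodule.span_le.2 h) (hN.preimage f.continuous)
  exact this hv

theorem exists_star_mul_self_of_mem {R : Type*} [NonUnitalCStarAlgebra R]
    (S : NonUnitalStarSubalgebra ℂ R) (hS : IsClosed (S : Set R)) {x y : R} (hx : x ∈ S)
    (h : x = star y * y) : ∃ z ∈ S, x = star z * z := by
  let _ := CStarAlgebra.spectralOrder R
  have := CStarAlgebra.spectralOrderedRing R
  have hx0 : 0 ≤ x := h ▸ star_mul_self_nonneg y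
  have hmem : CFC.sqrt x ∈ S := by
    have h1 : CFC.sqrt x = cfcₙ (fun z : ℂ => (Real.sqrt z.re : ℂ)) x := by
      rw [CFC.sqrt_eq_real_sqrt _ hx0, cfcₙ_real_eq_complex _ hx0.isSelfAdjoint]
    rw [h1]
    exact NonUnitalStarAlgebra.elemental.le_of_mem hS hx (cfcₙ_mem_elemental _ _)
  refine ⟨CFC.sqrt x, hmem, ?_⟩
  rw [(CFC.sqrt_nonneg _).isSelfAdjoint.star_eq, CFC.sqrt_mul_sqrt_self _ hx0]

/-- The norm closure of the linear span of a set of families of operators. -/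
def opSpan (t : Set (OpFamily 𝓗 𝓚)) : Submodule ℂ (OpFamily 𝓗 𝓚) :=
  (Submodule.span ℂ t).topologicalClosure

theorem isClosed_opSpan (t : Set (OpFamily 𝓗 𝓚)) : IsClosed (opSpan t : Set (OpFamily 𝓗 𝓚)) :=
  Submodule.isClosed_topologicalClosure _

theorem subset_opSpan (t : Set (OpFamily 𝓗 𝓚)) {T : OpFamily 𝓗 𝓚} (hT : T ∈ t) : T ∈ opSpan t :=
  Submodule.le_topologicalClosure _ (Submodule.subset_span hT)

theorem opComp_mem_opSpan {t : Set (OpFamily 𝓚 𝓛)} {s : Set (OpFamily 𝓗 𝓚)}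
    {r : Set (OpFamily 𝓗 𝓛)} (h : ∀ T ∈ t, ∀ S ∈ s, opComp T S ∈ r)
    {T : OpFamily 𝓚 𝓛} (hT : T ∈ opSpan t) {S : OpFamily 𝓗 𝓚} (hS : S ∈ opSpan s) :
    opComp T S ∈ opSpan r :=
  clm_mem_closure_span (opCompRight S) _ _ (isClosed_opSpan r) (fun T' hT' =>
    clm_mem_closure_span (opCompLeft T') _ _ (isClosed_opSpan r)
      (fun S' hS' => subset_opSpan r (h T' hT' S' hS')) hS) hT

theorem opAdj_mem_opSpan {t : Set (OpFamily 𝓗 𝓚)} {s : Set (OpFamily 𝓚 𝓗)}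
    (h : ∀ T ∈ t, opAdj T ∈ s) {T : OpFamily 𝓗 𝓚} (hT : T ∈ opSpan t) : opAdj T ∈ opSpan s := by
  have hadd : ∀ S T : OpFamily 𝓗 𝓚, opAdj (S + T) = opAdj S + opAdj T := fun S T =>
    opFamily_ext fun i => by simp
  have hsmul : ∀ (c : ℂ) (T : OpFamily 𝓗 𝓚), opAdj (c • T) = star c • opAdj T := fun c T =>
    opFamily_ext fun i => 
      (ContinuousLinearMap.adjoint (𝕜 := ℂ) (E := 𝓗 i) (F := 𝓚 i)).map_smulₛₗ c (T i)
  have hnorm : ∀ T : OpFamily 𝓗 𝓚, ‖opAdj T‖ ≤ 1 * ‖T‖ := fun T => by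
    rw [one_mul]
    refine opFamily_norm_le (norm_nonneg _) fun i => ?_
    rw [opAdj_apply, LinearIsometryEquiv.norm_map]
    exact opFamily_norm_apply_le T i
  let f : OpFamily 𝓗 𝓚 →L⋆[ℂ] OpFamily 𝓚 𝓗 :=
    LinearMap.mkContinuous { toFun := opAdj, map_add' := hadd, map_smul' := hsmul } 1 hnorm
  have : opSpan t ≤ (opSpan s).comap f.toLinearMap :=
    Submodule.topologicalClosure_minimal _
      (Submodule.span_le.2 fun T hT => subset_opSpan s (h T hT))
      ((isClosed_opSpan s).preimage f.continuous)
  exact this hT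

/-- A multiplicative and self-adjoint set spans a `C*`-algebra. -/
def opSpanAlgebra (s : Set (OpFamily 𝓗 𝓗)) (hmul : ∀ S ∈ s, ∀ T ∈ s, opComp S T ∈ s)
    (hstar : ∀ S ∈ s, opAdj S ∈ s) : NonUnitalStarSubalgebra ℂ (OpFamily 𝓗 𝓗) where
  carrier := opSpan s
  add_mem' := Submodule.add_mem _
  zero_mem' := Submodule.zero_mem _
  smul_mem' c _ := Submodule.smul_mem _ c
  mul_mem' ha hb := opComp_mem_opSpan hmul ha hb
  star_mem' ha := opAdj_mem_opSpan hstar ha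

end BoundedFamilies

section OperatorModules

set_option linter.unusedSectionVars false

variable {I : Type*} {𝓗 𝓚 : I → Type*}
  [∀ i, NormedAddCommGroup (𝓗 i)] [∀ i, InnerProductSpace ℂ (𝓗 i)] [∀ i, CompleteSpace (𝓗 i)]
  [∀ i, NormedAddCommGroup (𝓚 i)] [∀ i, InnerProductSpace ℂ (𝓚 i)] [∀ i, CompleteSpace (𝓚 i)]

/-- A set of families of operators that is closed under products and adjoints. -/
class IsOpAlgebra (s : Set (OpFamily 𝓗 𝓗)) : Prop where
  comp_mem : ∀ S ∈ s, ∀ T ∈ s, opComp S T ∈ s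
  adj_mem : ∀ S ∈ s, opAdj S ∈ s

/-- A set `t` of families of operators with `t s ⊆ t` and `t* t ⊆ s`. -/
class IsOpModule (s : Set (OpFamily 𝓗 𝓗)) (t : Set (OpFamily 𝓗 𝓚)) : Prop where
  comp_mem : ∀ T ∈ t, ∀ S ∈ s, opComp T S ∈ t
  adj_comp_mem : ∀ T ∈ t, ∀ T' ∈ t, opComp (opAdj T) T' ∈ s

/-- The `C*`-algebra spanned by `s`. -/
def OpAlgebra (s : Set (OpFamily 𝓗 𝓗)) [IsOpAlgebra s] : Type _ :=
  opSpanAlgebra s IsOpAlgebra.comp_mem IsOpAlgebra.adj_mem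

instance (s : Set (OpFamily 𝓗 𝓗)) [IsOpAlgebra s] : NonUnitalCStarAlgebra (OpAlgebra s) :=
  NonUnitalStarSubalgebra.nonUnitalCStarAlgebra
    (opSpanAlgebra s IsOpAlgebra.comp_mem IsOpAlgebra.adj_mem) (h_closed := isClosed_opSpan s)

instance (s : Set (OpFamily 𝓗 𝓗)) [IsOpAlgebra s] : PartialOrder (OpAlgebra s) :=
  CStarAlgebra.spectralOrder (OpAlgebra s)

instance (s : Set (OpFamily 𝓗 𝓗)) [IsOpAlgebra s] : StarOrderedRing (OpAlgebra s) :=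
  CStarAlgebra.spectralOrderedRing (OpAlgebra s)

set_option linter.unusedVariables false in
/-- The Hilbert module over the `C*`-algebra spanned by `s` that is spanned by `t`. -/
def OpModule (s : Set (OpFamily 𝓗 𝓗)) (t : Set (OpFamily 𝓗 𝓚)) : Type _ := opSpan t

variable (s : Set (OpFamily 𝓗 𝓗)) (t : Set (OpFamily 𝓗 𝓚))

instance : NormedAddCommGroup (OpModule s t) := inferInstanceAs (NormedAddCommGroup (opSpan t))
instance : NormedSpace ℂ (OpModule s t) := inferInstanceAs (NormedSpace ℂ (opSpan t))
instance : CompleteSpace (OpModule s t) := (isClosed_opSpan t).completeSpace_coe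

/-- The underlying family of operators. -/
def OpAlgebra.val [IsOpAlgebra s] : OpAlgebra s →L[ℂ] OpFamily 𝓗 𝓗 := (opSpan s).subtypeL

/-- The underlying family of operators. -/
def OpModule.val : OpModule s t →L[ℂ] OpFamily 𝓗 𝓚 := (opSpan t).subtypeL

variable {s t}

theorem OpAlgebra.val_mem [IsOpAlgebra s] (S : OpAlgebra s) : val s S ∈ opSpan s := S.2

theorem OpModule.val_mem (T : OpModule s t) : val s t T ∈ opSpan t := T.2

theorem OpAlgebra.ext [IsOpAlgebra s] {S S' : OpAlgebra s} (h : val s S = val s S') : S = S' :=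
  Subtype.ext h

theorem OpModule.ext {T T' : OpModule s t} (h : val s t T = val s t T') : T = T' :=
  Subtype.ext h

theorem OpAlgebra.norm_val [IsOpAlgebra s] (S : OpAlgebra s) : ‖val s S‖ = ‖S‖ := rfl

theorem OpModule.norm_val (T : OpModule s t) : ‖val s t T‖ = ‖T‖ := rfl

theorem OpAlgebra.val_mul [IsOpAlgebra s] (S S' : OpAlgebra s) :
    val s (S * S') = opComp (val s S) (val s S') := rfl

theorem OpAlgebra.val_star [IsOpAlgebra s] (S : OpAlgebra s) :
    val s (star S) = opAdj (val s S) := rfl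

/-- An element of the spanned `C*`-algebra. -/
def OpAlgebra.mk [IsOpAlgebra s] (S : OpFamily 𝓗 𝓗) (hS : S ∈ opSpan s) : OpAlgebra s := ⟨S, hS⟩

/-- An element of the spanned Hilbert module. -/
def OpModule.mk (s : Set (OpFamily 𝓗 𝓗)) (T : OpFamily 𝓗 𝓚) (hT : T ∈ opSpan t) :
    OpModule s t := ⟨T, hT⟩

theorem OpAlgebra.val_mk [IsOpAlgebra s] (S : OpFamily 𝓗 𝓗) (hS : S ∈ opSpan s) :
    val s (mk S hS) = S := rfl

theorem OpModule.val_mk (T : OpFamily 𝓗 𝓚) (hT : T ∈ opSpan t) : val s t (mk s T hT) = T := rfl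

/-- `T* T'` belongs to the spanned algebra. -/
theorem opComp_opAdj_mem_opSpan [IsOpModule s t] {T T' : OpFamily 𝓗 𝓚} (hT : T ∈ opSpan t)
    (hT' : T' ∈ opSpan t) : opComp (opAdj T) T' ∈ opSpan s := by
  refine opComp_mem_opSpan (t := opAdj '' t) (s := t) ?_ (opAdj_mem_opSpan ?_ hT) hT'
  · rintro _ ⟨T, hT, rfl⟩ T' hT'
    exact IsOpModule.adj_comp_mem T hT T' hT'
  · exact fun T hT => ⟨T, hT, rfl⟩

variable [IsOpAlgebra s] [IsOpModule s t]

/-- The right action is composition. -/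
instance : SMul (OpAlgebra s)ᵐᵒᵖ (OpModule s t) where
  smul S T := OpModule.mk s (opComp (OpModule.val s t T) (OpAlgebra.val s S.unop))
    (opComp_mem_opSpan IsOpModule.comp_mem T.val_mem (OpAlgebra.val_mem S.unop))

theorem OpModule.val_op_smul (T : OpModule s t) (S : OpAlgebra s) :
    val s t (T <• S) = opComp (val s t T) (OpAlgebra.val s S) := rfl

/-- The inner product `⟨T | T'⟩ = T* T'`. -/
def OpModule.inner (T T' : OpModule s t) : OpAlgebra s :=
  OpAlgebra.mk (opComp (opAdj (val s t T)) (val s t T'))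
    (opComp_opAdj_mem_opSpan T.val_mem T'.val_mem)

theorem OpModule.val_inner (T T' : OpModule s t) :
    OpAlgebra.val s (OpModule.inner T T') = opComp (opAdj (val s t T)) (val s t T') := rfl

theorem exists_adj_comp_self {T : OpFamily 𝓗 𝓚} (h : opComp (opAdj T) T ∈ opSpan s) :
    ∃ S ∈ opSpan s, opComp (opAdj T) T = opComp (opAdj S) S := by
  obtain ⟨y, hy⟩ := opFamily_exists_adj_comp_self T
  exact exists_star_mul_self_of_mem (R := OpFamily 𝓗 𝓗)
    (opSpanAlgebra s IsOpAlgebra.comp_mem IsOpAlgebra.adj_mem) (isClosed_opSpan s) h hy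

theorem OpModule.inner_self_nonneg (T : OpModule s t) : 0 ≤ OpModule.inner T T := by
  obtain ⟨S, hS, h⟩ := exists_adj_comp_self (OpAlgebra.val_mem (OpModule.inner T T))
  have h2 : OpModule.inner T T = star (OpAlgebra.mk S hS) * OpAlgebra.mk S hS := OpAlgebra.ext h
  rw [h2]
  exact star_mul_self_nonneg _

theorem OpModule.norm_sq_eq (T : OpModule s t) : ‖T‖ ^ 2 = ‖OpModule.inner T T‖ := by
  rw [← OpAlgebra.norm_val, OpModule.val_inner, opFamily_norm_adj_comp_self, OpModule.norm_val]

theorem OpModule.star_inner (x y : OpModule s t) :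
    star (OpModule.inner x y) = OpModule.inner y x := OpAlgebra.ext <| by
  rw [OpAlgebra.val_star, OpModule.val_inner, OpModule.val_inner, opAdj_opComp, opAdj_opAdj]

theorem OpModule.inner_add (x y z : OpModule s t) :
    OpModule.inner x (y + z) = OpModule.inner x y + OpModule.inner x z := OpAlgebra.ext <| by
  rw [map_add, OpModule.val_inner, OpModule.val_inner, OpModule.val_inner, map_add, opComp_add]

theorem OpModule.inner_smul (c : ℂ) (x y : OpModule s t) :
    OpModule.inner x (c • y) = c • OpModule.inner x y := OpAlgebra.ext <| by
  rw [map_smul, OpModule.val_inner, OpModule.val_inner, map_smul, opComp_smul]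

theorem OpModule.inner_op_smul (x y : OpModule s t) (b : OpAlgebra s) :
    OpModule.inner x (y <• b) = OpModule.inner x y * b := OpAlgebra.ext <| by
  rw [OpAlgebra.val_mul, OpModule.val_inner, OpModule.val_inner, OpModule.val_op_smul, opComp_assoc]

instance : InnerProductModule (OpAlgebra s) (OpModule s t) where
  ip := OpModule.inner
  ip_add_right := OpModule.inner_add
  ip_smul_right := OpModule.inner_smul
  ip_op_smul_right := OpModule.inner_op_smul
  star_ip := OpModule.star_inner
  ip_self_nonneg := OpModule.inner_self_nonneg
  norm_sq_eq := OpModule.norm_sq_eq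

theorem OpModule.ip_def (T T' : OpModule s t) : ip (B := OpAlgebra s) T T' = OpModule.inner T T' :=
  rfl

/-- A representation `D` of `A` by families of operators with `D t ⊆ t` gives a left action on the
Hilbert module spanned by `t`. -/
def OpModule.leftAction {A : Type*} [CStarAlgebra A] (D : A → OpFamily 𝓚 𝓚)
    (hadd : ∀ a a', D (a + a') = D a + D a') (hsmul : ∀ (c : ℂ) a, D (c • a) = c • D a)
    (hmul : ∀ a a', D (a * a') = opComp (D a) (D a')) (hadj : ∀ a, opAdj (D a) = D (star a))
    (hmem : ∀ a, ∀ T ∈ t, opComp (D a) T ∈ t) : LeftAction A (OpAlgebra s) (OpModule s t) where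
  hom :=
    { toFun := fun a =>
        { toFun := fun T => OpModule.mk s (opComp (D a) (OpModule.val s t T))
            (clm_mem_closure_span (opCompLeft (D a)) t (opSpan t) (isClosed_opSpan t)
              (fun T hT => subset_opSpan t (hmem a T hT)) T.val_mem)
          map_add' := fun T T' => OpModule.ext <| by
            change opComp (D a) (OpModule.val s t T + OpModule.val s t T')
              = opComp (D a) (OpModule.val s t T) + opComp (D a) (OpModule.val s t T')
            rw [opComp_add]
          map_smul' := fun c T => OpModule.ext <| by
            change opComp (D a) (c • OpModule.val s t T) = c • opComp (D a) (OpModule.val s t T)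
            rw [opComp_smul] }
      map_smul' := fun c a => LinearMap.ext fun T => OpModule.ext <| by
        change opComp (D (c • a)) (OpModule.val s t T) = c • opComp (D a) (OpModule.val s t T)
        rw [hsmul, smul_opComp]
      map_zero' := LinearMap.ext fun T => OpModule.ext <| by
        change opComp (D 0) (OpModule.val s t T) = 0
        rw [← zero_smul ℂ (0 : A), hsmul, smul_opComp, zero_smul]
      map_add' := fun a a' => LinearMap.ext fun T => OpModule.ext <| by
        change opComp (D (a + a')) (OpModule.val s t T)
          = opComp (D a) (OpModule.val s t T) + opComp (D a') (OpModule.val s t T)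
        rw [hadd, add_opComp]
      map_mul' := fun a a' => LinearMap.ext fun T => OpModule.ext <| by
        change opComp (D (a * a')) (OpModule.val s t T)
          = opComp (D a) (opComp (D a') (OpModule.val s t T))
        rw [hmul, opComp_assoc] }
  ip_hom_left a x y := OpAlgebra.ext <| by
    change opComp (opAdj (opComp (D a) (OpModule.val s t x))) (OpModule.val s t y)
      = opComp (opAdj (OpModule.val s t x)) (opComp (D (star a)) (OpModule.val s t y))
    rw [opAdj_opComp, hadj, opComp_assoc]

end OperatorModules

/-! ### Hilbert space tensor products -/

section HilbertTensor

set_option linter.unusedSectionVars false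

variable (H K : Type*) [NormedAddCommGroup H] [InnerProductSpace ℂ H] [CompleteSpace H]
  [NormedAddCommGroup K] [InnerProductSpace ℂ K] [CompleteSpace K]

/-- The Hilbert space tensor product. -/
abbrev HilbertTensor : Type _ := HilbertCompletion (H ⊗[ℂ] K)

namespace HilbertTensor

variable {H K}

/-- The inclusion of the algebraic tensor product. -/
def incl : H ⊗[ℂ] K →ₗᵢ[ℂ] HilbertTensor H K := UniformSpace.Completion.toComplₗᵢ

theorem denseRange_incl : DenseRange (incl (H := H) (K := K)) :=
  UniformSpace.Completion.denseRange_coe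

/-- The elementary tensor `x ⊗ y`. -/
def tmul (x : H) (y : K) : HilbertTensor H K := incl (x ⊗ₜ[ℂ] y)

theorem inner_tmul (x x' : H) (y y' : K) :
    inner ℂ (tmul x y) (tmul x' y') = inner ℂ x x' * inner ℂ y y' := by
  rw [tmul, tmul, LinearIsometry.inner_map_map, TensorProduct.inner_tmul]

variable (H K) in
theorem span_tmul : (Submodule.span ℂ (Set.range fun z : H × K =>
    tmul z.1 z.2)).topologicalClosure = ⊤ := by
  rw [eq_top_iff]
  rintro x -
  refine denseRange_incl.induction_on x
    (Submodule.isClosed_topologicalClosure _) fun x => Submodule.le_topologicalClosure _ ?_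
  induction x using TensorProduct.induction_on with
  | zero => rw [map_zero]; exact Submodule.zero_mem _
  | tmul x y => exact Submodule.subset_span ⟨(x, y), rfl⟩
  | add x y hx hy => rw [map_add]; exact Submodule.add_mem _ hx hy

variable {H' K' : Type*} [NormedAddCommGroup H'] [InnerProductSpace ℂ H'] [CompleteSpace H']
  [NormedAddCommGroup K'] [InnerProductSpace ℂ K'] [CompleteSpace K']

/-- The operator `S ⊗ T`. -/
def map (S : H →L[ℂ] H') (T : K →L[ℂ] K') : HilbertTensor H K →L[ℂ] HilbertTensor H' K' :=
  (TensorProduct.mapL S T).completion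

theorem map_tmul (S : H →L[ℂ] H') (T : K →L[ℂ] K') (x : H) (y : K) :
    map S T (tmul x y) = tmul (S x) (T y) :=
  ContinuousLinearMap.completion_apply_coe _ _

theorem ext_tmul {R S : HilbertTensor H K →L[ℂ] HilbertTensor H' K'}
    (h : ∀ x y, R (tmul x y) = S (tmul x y)) : R = S := by
  have hd : Dense (Submodule.span ℂ (Set.range fun z : H × K =>
      tmul z.1 z.2) : Set (HilbertTensor H K)) := by
    rw [Submodule.dense_iff_topologicalClosure_eq_top]
    exact span_tmul H K
  refine ContinuousLinearMap.ext_on hd ?_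
  rintro _ ⟨z, rfl⟩
  exact h _ _

theorem norm_map_le (S : H →L[ℂ] H') (T : K →L[ℂ] K') : ‖map S T‖ ≤ ‖S‖ * ‖T‖ := by
  refine ContinuousLinearMap.opNorm_le_bound _ (by positivity) fun x => ?_
  refine denseRange_incl.induction_on x
    (isClosed_le (ContinuousLinearMap.continuous _).norm
      (continuous_const.mul continuous_norm)) fun x => ?_
  have h : map S T (incl x) = incl (TensorProduct.mapL S T x) :=
    ContinuousLinearMap.completion_apply_coe _ _
  rw [h, LinearIsometry.norm_map, LinearIsometry.norm_map]
  exact ContinuousLinearMap.le_of_opNorm_le _ (TensorProduct.norm_mapL_le S T) x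

theorem inner_ext_tmul {v w : HilbertTensor H K}
    (h : ∀ x y, inner ℂ (tmul x y) v = inner ℂ (tmul x y) w) : v = w := by
  refine ext_inner_left ℂ fun u => ?_
  have hu : u ∈ (Submodule.span ℂ (Set.range fun z : H × K =>
      tmul z.1 z.2)).topologicalClosure := by rw [span_tmul]; trivial
  have h2 : (innerSL ℂ (v - w)) u ∈ (⊥ : Submodule ℂ ℂ) := by
    refine clm_mem_closure_span (innerSL ℂ (v - w)) _ ⊥ (by simp) ?_ hu
    rintro _ ⟨z, rfl⟩
    have := h z.1 z.2
    rw [Submodule.mem_bot, innerSL_apply_apply, ← inner_conj_symm]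
    simp only [inner_sub_right]
    rw [this, sub_self, map_zero]
  rw [Submodule.mem_bot, innerSL_apply_apply, ← inner_conj_symm, map_eq_zero,
    inner_sub_right] at h2
  exact sub_eq_zero.1 h2

theorem adjoint_map (S : H →L[ℂ] H') (T : K →L[ℂ] K') :
    (map S T).adjoint = map S.adjoint T.adjoint := by
  refine ext_tmul fun x y => inner_ext_tmul fun x' y' => ?_
  rw [ContinuousLinearMap.adjoint_inner_right, map_tmul, map_tmul,
    inner_tmul, inner_tmul, ContinuousLinearMap.adjoint_inner_right,
    ContinuousLinearMap.adjoint_inner_right]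

theorem map_comp {H'' K'' : Type*}
    [NormedAddCommGroup H''] [InnerProductSpace ℂ H''] [CompleteSpace H'']
    [NormedAddCommGroup K''] [InnerProductSpace ℂ K''] [CompleteSpace K'']
    (S' : H' →L[ℂ] H'') (T' : K' →L[ℂ] K'') (S : H →L[ℂ] H') (T : K →L[ℂ] K') :
    map S' T' ∘L map S T = map (S' ∘L S) (T' ∘L T) :=
  ext_tmul fun x y => by
    rw [ContinuousLinearMap.comp_apply, map_tmul, map_tmul, map_tmul]; rfl

theorem tmul_add_left (x x' : H) (y : K) : tmul (x + x') y = tmul x y + tmul x' y := by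
  rw [tmul, TensorProduct.add_tmul, map_add]; rfl

theorem tmul_add_right (x : H) (y y' : K) : tmul x (y + y') = tmul x y + tmul x y' := by
  rw [tmul, TensorProduct.tmul_add, map_add]; rfl

theorem tmul_smul_left (c : ℂ) (x : H) (y : K) : tmul (c • x) y = c • tmul x y := by
  rw [tmul, ← TensorProduct.smul_tmul', map_smul]; rfl

theorem tmul_smul_right (c : ℂ) (x : H) (y : K) : tmul x (c • y) = c • tmul x y := by
  rw [tmul, TensorProduct.tmul_smul, map_smul]; rfl

theorem map_add_left (S S' : H →L[ℂ] H') (T : K →L[ℂ] K') :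
    map (S + S') T = map S T + map S' T :=
  ext_tmul fun x y => by
    rw [add_apply, map_tmul, map_tmul, map_tmul, add_apply, tmul_add_left]

theorem map_add_right (S : H →L[ℂ] H') (T T' : K →L[ℂ] K') :
    map S (T + T') = map S T + map S T' :=
  ext_tmul fun x y => by
    rw [add_apply, map_tmul, map_tmul, map_tmul, add_apply, tmul_add_right]

theorem map_smul_left (c : ℂ) (S : H →L[ℂ] H') (T : K →L[ℂ] K') :
    map (c • S) T = c • map S T :=
  ext_tmul fun x y => by
    rw [smul_apply, map_tmul, map_tmul, smul_apply, tmul_smul_left]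

theorem map_smul_right (c : ℂ) (S : H →L[ℂ] H') (T : K →L[ℂ] K') :
    map S (c • T) = c • map S T :=
  ext_tmul fun x y => by
    rw [smul_apply, map_tmul, map_tmul, smul_apply, tmul_smul_right]

end HilbertTensor

end HilbertTensor

/-! ### The minimal tensor product and the exterior tensor product -/

section Tensor

theorem ket_one {B : Type*} [CStarAlgebra B] [PartialOrder B] [StarOrderedRing B]
    (ω : B →ₚ[ℂ] ℂ) : ket ω (1 : B) = ContinuousLinearMap.id ℂ (Loc ω B) :=
  loc_ext ω fun b => by
    rw [ket_coe]
    change toLoc ω (1 * b) = toLoc ω b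
    rw [one_mul]

theorem adjoint_ket {B : Type*} [CStarAlgebra B] [PartialOrder B] [StarOrderedRing B]
    (ω : B →ₚ[ℂ] ℂ) (b : B) : (ket ω b).adjoint = ket ω (star b) := by
  have h := adjoint_ket_comp_ket ω b (1 : B)
  rw [ket_one, ContinuousLinearMap.comp_id] at h
  rw [h]
  change ket ω (star b * 1) = ket ω (star b)
  rw [mul_one]

variable (B C E G : Type*)
  [CStarAlgebra B] [PartialOrder B] [StarOrderedRing B]
  [CStarAlgebra C] [PartialOrder C] [StarOrderedRing C]
  [NormedAddCommGroup E] [NormedSpace ℂ E] [SMul Bᵐᵒᵖ E] [InnerProductModule B E]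
  [NormedAddCommGroup G] [NormedSpace ℂ G] [SMul Cᵐᵒᵖ G] [InnerProductModule C G]

/-- The pairs of positive functionals on `B` and on `C`. -/
abbrev FunctionalPair := (B →ₚ[ℂ] ℂ) × (C →ₚ[ℂ] ℂ)

variable {B C}

/-- The Hilbert space tensor product of the completions of `E` and `G` for a pair of functionals. -/
abbrev PairSpace (p : FunctionalPair B C) : Type _ := HilbertTensor (Loc p.1 E) (Loc p.2 G)

variable {E G}

variable (B C)

/-- The elementary tensor `e ⊗ g` as a family of operators, indexed by the pairs of positive
functionals `ω` on `B` and `η` on `C`: it sends `b ⊗ c` to `(e b) ⊗ (g c)`. -/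
def pairOp (e : E) (g : G) : OpFamily (PairSpace (B := B) (C := C) B C) (PairSpace E G) :=
  opMk (fun p => HilbertTensor.map (ket p.1 e) (ket p.2 g)) (‖e‖ * ‖g‖) fun p =>
    (HilbertTensor.norm_map_le _ _).trans
      (mul_le_mul (norm_ket_le _ _) (norm_ket_le _ _) (norm_nonneg (ket p.2 g)) (norm_nonneg _))

theorem pairOp_apply (e : E) (g : G) (p : FunctionalPair B C) :
    pairOp B C e g p = HilbertTensor.map (ket p.1 e) (ket p.2 g) := rfl

theorem opComp_pairOp (e : E) (g : G) (b : B) (c : C) :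
    opComp (pairOp B C e g) (pairOp B C b c) = pairOp B C (e <• b) (g <• c) :=
  opFamily_ext fun p => by
    change HilbertTensor.map (ket p.1 e) (ket p.2 g) ∘L HilbertTensor.map (ket p.1 b) (ket p.2 c)
      = HilbertTensor.map (ket p.1 (e <• b)) (ket p.2 (g <• c))
    rw [HilbertTensor.map_comp, ket_comp_ket, ket_comp_ket]

theorem opComp_opAdj_pairOp (e e' : E) (g g' : G) :
    opComp (opAdj (pairOp B C e g)) (pairOp B C e' g')
      = pairOp B C (ip (B := B) e e') (ip (B := C) g g') :=
  opFamily_ext fun p => by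
    change (HilbertTensor.map (ket p.1 e) (ket p.2 g)).adjoint ∘L
        HilbertTensor.map (ket p.1 e') (ket p.2 g')
      = HilbertTensor.map (ket p.1 (ip (B := B) e e')) (ket p.2 (ip (B := C) g g'))
    rw [HilbertTensor.adjoint_map, HilbertTensor.map_comp, adjoint_ket_comp_ket,
      adjoint_ket_comp_ket]

/-- The elementary tensors `e ⊗ g`. -/
def elementary (B C E G : Type*)
    [CStarAlgebra B] [PartialOrder B] [StarOrderedRing B]
    [CStarAlgebra C] [PartialOrder C] [StarOrderedRing C]
    [NormedAddCommGroup E] [NormedSpace ℂ E] [SMul Bᵐᵒᵖ E] [InnerProductModule B E]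
    [NormedAddCommGroup G] [NormedSpace ℂ G] [SMul Cᵐᵒᵖ G] [InnerProductModule C G] :
    Set (OpFamily (PairSpace (B := B) (C := C) B C) (PairSpace E G)) :=
  Set.range fun z : E × G => pairOp B C z.1 z.2

theorem pairOp_mem_elementary (e : E) (g : G) : pairOp B C e g ∈ elementary B C E G :=
  ⟨(e, g), rfl⟩

theorem opAdj_pairOp (b : B) (c : C) : opAdj (pairOp B C b c) = pairOp B C (star b) (star c) :=
  opFamily_ext fun p => by
    change (HilbertTensor.map (ket p.1 b) (ket p.2 c)).adjoint
      = HilbertTensor.map (ket p.1 (star b)) (ket p.2 (star c))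
    rw [HilbertTensor.adjoint_map, adjoint_ket, adjoint_ket]

instance : IsOpAlgebra (elementary B C B C) where
  comp_mem := by
    rintro _ ⟨z, rfl⟩ _ ⟨w, rfl⟩
    rw [opComp_pairOp]
    exact pairOp_mem_elementary B C _ _
  adj_mem := by
    rintro _ ⟨z, rfl⟩
    rw [opAdj_pairOp]
    exact pairOp_mem_elementary B C _ _

instance : IsOpModule (elementary B C B C) (elementary B C E G) where
  comp_mem := by
    rintro _ ⟨z, rfl⟩ _ ⟨w, rfl⟩
    rw [opComp_pairOp]
    exact pairOp_mem_elementary B C _ _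
  adj_comp_mem := by
    rintro _ ⟨z, rfl⟩ _ ⟨w, rfl⟩
    rw [opComp_opAdj_pairOp]
    exact pairOp_mem_elementary B C _ _

/-- The minimal (spatial) tensor product `B ⊗ C`: the `C*`-algebra spanned by the operators `b ⊗ c`
on the tensor products of the spaces of the Gelfand-Naimark-Segal representations of `B` and of `C`
for all positive functionals. These together are the tensor product of the universal
representations, which are faithful. -/
abbrev MinTensor : Type _ := OpAlgebra (elementary B C B C)

variable (E G) in
/-- The exterior tensor product `E ⊗ G`, a Hilbert module over `B ⊗ C`: the closed span of the
elementary tensors, with `⟨e ⊗ g | e' ⊗ g'⟩ = ⟨e | e'⟩ ⊗ ⟨g | g'⟩`. -/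
abbrev ExtTensor : Type _ := OpModule (elementary B C B C) (elementary B C E G)

variable {B C} in
/-- The elementary tensor `b ⊗ c`. -/
def minTmul (b : B) (c : C) : MinTensor B C :=
  OpAlgebra.mk (pairOp B C b c) (subset_opSpan _ (pairOp_mem_elementary B C b c))

/-- The elementary tensor `e ⊗ g`. -/
def extTmul (e : E) (g : G) : ExtTensor B C E G :=
  OpModule.mk _ (pairOp B C e g) (subset_opSpan _ (pairOp_mem_elementary B C e g))

theorem ip_extTmul (e e' : E) (g g' : G) :
    ip (B := MinTensor B C) (extTmul B C e g) (extTmul B C e' g')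
      = minTmul (ip e e') (ip g g') :=
  OpAlgebra.ext (opComp_opAdj_pairOp B C e e' g g')

theorem extTmul_op_smul (e : E) (g : G) (b : B) (c : C) :
    extTmul B C e g <• minTmul b c = extTmul B C (e <• b) (g <• c) :=
  OpModule.ext (opComp_pairOp B C e g b c)

theorem norm_extTmul_le (e : E) (g : G) : ‖extTmul B C e g‖ ≤ ‖e‖ * ‖g‖ :=
  opFamily_norm_le (mul_nonneg (norm_nonneg e) (norm_nonneg g)) fun p =>
    (HilbertTensor.norm_map_le _ _).trans
      (mul_le_mul (norm_ket_le _ _) (norm_ket_le _ _) (norm_nonneg (ket p.2 g)) (norm_nonneg _))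

theorem pairOp_add_left (e e' : E) (g : G) :
    pairOp B C (e + e') g = pairOp B C e g + pairOp B C e' g :=
  opFamily_ext fun p => by
    change HilbertTensor.map (ket p.1 (e + e')) (ket p.2 g)
      = HilbertTensor.map (ket p.1 e) (ket p.2 g) + HilbertTensor.map (ket p.1 e') (ket p.2 g)
    rw [ket_add, HilbertTensor.map_add_left]

theorem pairOp_add_right (e : E) (g g' : G) :
    pairOp B C e (g + g') = pairOp B C e g + pairOp B C e g' :=
  opFamily_ext fun p => by
    change HilbertTensor.map (ket p.1 e) (ket p.2 (g + g'))
      = HilbertTensor.map (ket p.1 e) (ket p.2 g) + HilbertTensor.map (ket p.1 e) (ket p.2 g')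
    rw [ket_add, HilbertTensor.map_add_right]

theorem pairOp_smul_left (c : ℂ) (e : E) (g : G) :
    pairOp B C (c • e) g = c • pairOp B C e g :=
  opFamily_ext fun p => by
    change HilbertTensor.map (ket p.1 (c • e)) (ket p.2 g)
      = c • HilbertTensor.map (ket p.1 e) (ket p.2 g)
    rw [ket_smul, HilbertTensor.map_smul_left]

theorem pairOp_smul_right (c : ℂ) (e : E) (g : G) :
    pairOp B C e (c • g) = c • pairOp B C e g :=
  opFamily_ext fun p => by
    change HilbertTensor.map (ket p.1 e) (ket p.2 (c • g))
      = c • HilbertTensor.map (ket p.1 e) (ket p.2 g)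
    rw [ket_smul, HilbertTensor.map_smul_right]

variable {B C}

/-! The left action `a (e ⊗ g) = (a e) ⊗ g` -/

variable {A : Type*} [CStarAlgebra A] (L : LeftAction A B E)

/-- The operators `a ⊗ 1`. -/
def actFamily (a : A) :
    OpFamily (PairSpace (B := B) (C := C) E G) (PairSpace (B := B) (C := C) E G) :=
  opMk (fun p => HilbertTensor.map (act p.1 L a) (ContinuousLinearMap.id ℂ _)) (‖a‖ * 1) fun _ =>
    (HilbertTensor.norm_map_le _ _).trans
      (mul_le_mul (norm_act_le _ _ _) ContinuousLinearMap.norm_id_le (norm_nonneg _)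
        (norm_nonneg _))

theorem opComp_actFamily_pairOp (a : A) (e : E) (g : G) :
    opComp (actFamily (G := G) L a) (pairOp B C e g) = pairOp B C (L.hom a e) g :=
  opFamily_ext fun p => by
    change HilbertTensor.map (act p.1 L a) (ContinuousLinearMap.id ℂ (Loc p.2 G)) ∘L
        HilbertTensor.map (ket p.1 e) (ket p.2 g)
      = HilbertTensor.map (ket p.1 (L.hom a e)) (ket p.2 g)
    rw [HilbertTensor.map_comp, act_comp_ket, ContinuousLinearMap.id_comp]

theorem opAdj_actFamily (a : A) :
    opAdj (actFamily (C := C) (G := G) L a) = actFamily L (star a) :=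
  opFamily_ext fun p => by
    change (HilbertTensor.map (act p.1 L a) (ContinuousLinearMap.id ℂ (Loc p.2 G))).adjoint
      = HilbertTensor.map (act p.1 L (star a)) (ContinuousLinearMap.id ℂ (Loc p.2 G))
    rw [HilbertTensor.adjoint_map, adjoint_act, ContinuousLinearMap.adjoint_id]

theorem actFamily_add (a a' : A) :
    actFamily (C := C) (G := G) L (a + a') = actFamily L a + actFamily L a' :=
  opFamily_ext fun p => by
    change HilbertTensor.map (act p.1 L (a + a')) (ContinuousLinearMap.id ℂ (Loc p.2 G))
      = HilbertTensor.map (act p.1 L a) (ContinuousLinearMap.id ℂ (Loc p.2 G))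
        + HilbertTensor.map (act p.1 L a') (ContinuousLinearMap.id ℂ (Loc p.2 G))
    rw [act_add, HilbertTensor.map_add_left]

theorem actFamily_smul (c : ℂ) (a : A) :
    actFamily (C := C) (G := G) L (c • a) = c • actFamily L a :=
  opFamily_ext fun p => by
    change HilbertTensor.map (act p.1 L (c • a)) (ContinuousLinearMap.id ℂ (Loc p.2 G))
      = c • HilbertTensor.map (act p.1 L a) (ContinuousLinearMap.id ℂ (Loc p.2 G))
    rw [act_smul, HilbertTensor.map_smul_left]

theorem actFamily_mul (a a' : A) :
    actFamily (C := C) (G := G) L (a * a') = opComp (actFamily L a) (actFamily L a') :=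
  opFamily_ext fun p => by
    change HilbertTensor.map (act p.1 L (a * a')) (ContinuousLinearMap.id ℂ (Loc p.2 G))
      = HilbertTensor.map (act p.1 L a) (ContinuousLinearMap.id ℂ (Loc p.2 G))
        ∘L HilbertTensor.map (act p.1 L a') (ContinuousLinearMap.id ℂ (Loc p.2 G))
    rw [HilbertTensor.map_comp, act_mul, ContinuousLinearMap.id_comp]

variable (C G) in
/-- The left action of `A` on `E ⊗ G` induced by the one on `E`, `a (e ⊗ g) = (a e) ⊗ g`. -/
def extAction : LeftAction A (MinTensor B C) (ExtTensor B C E G) :=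
  OpModule.leftAction (actFamily L) (actFamily_add L) (actFamily_smul L) (actFamily_mul L)
    (opAdj_actFamily L) fun a => by
      rintro _ ⟨z, rfl⟩
      rw [opComp_actFamily_pairOp]
      exact pairOp_mem_elementary B C _ _

theorem extAction_extTmul (a : A) (e : E) (g : G) :
    (extAction C G L).hom a (extTmul B C e g) = extTmul B C (L.hom a e) g :=
  OpModule.ext (opComp_actFamily_pairOp L a e g)

end Tensor

/-! ### Sums, integrals, and completely positive kernels -/

section Kernels

/-- The `n`-th partial sum of a finite or infinite series `∑ f k`, where `k` runs over the natural
numbers with `k < N`. -/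
def partialSum {V : Type*} [AddCommMonoid V] (N : ℕ∞) (f : ℕ → V) (n : ℕ) : V :=
  ∑ k ∈ (Finset.range n).filter (fun k : ℕ => (k : ℕ∞) < N), f k

/-- The series `∑ f k`, over `k < N`, converges to `v`. -/
def SumsTo {V : Type*} [AddCommMonoid V] [TopologicalSpace V] (N : ℕ∞) (f : ℕ → V) (v : V) : Prop :=
  Tendsto (partialSum N f) atTop (𝓝 v)

/-- `F : X → E` is measurable and `⟨F x | F x⟩` is Bochner integrable. -/
def SqIntegrable (B : Type*) {E X : Type*} [NonUnitalCStarAlgebra B] [PartialOrder B]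
    [NormedAddCommGroup E] [NormedSpace ℂ E] [SMul Bᵐᵒᵖ E] [InnerProductModule B E]
    [MeasurableSpace X] (F : X → E) (μ : Measure X) : Prop :=
  AEStronglyMeasurable F μ ∧ Integrable (fun x => ip (B := B) (F x) (F x)) μ

/-- The Pettis integral of `f` with respect to `μ` exists and is `v`. -/
def HasPettisIntegral {V X : Type*} [NormedAddCommGroup V] [NormedSpace ℂ V] [MeasurableSpace X]
    (f : X → V) (μ : Measure X) (v : V) : Prop :=
  (∀ ψ : V →L[ℂ] ℂ, Integrable (fun x => ψ (f x)) μ) ∧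
  ∃ J : Set X → V, J Set.univ = v ∧
    ∀ s, MeasurableSet s → ∀ ψ : V →L[ℂ] ℂ, ∫ x in s, ψ (f x) ∂μ = ψ (J s)

/-- `K : X × X → L(A, D)` is a completely positive kernel. -/
def IsCPKernel {A D X : Type*} [CStarAlgebra A] [NonUnitalCStarAlgebra D] [PartialOrder D]
    (K : X → X → A →L[ℂ] D) : Prop :=
  ∀ (n : ℕ) (x : Fin n → X) (a : Fin n → A) (d : Fin n → D),
    0 ≤ ∑ i, ∑ j, star (d i) * K (x i) (x j) (star (a i) * a j) * d j

/-- The correspondence `E` with left action `L` and the map `v : X → E` form a Kolmogorov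
decomposition of the kernel `K`. -/
def IsKolmogorovDecomposition {A D E X : Type*} [CStarAlgebra A] [NonUnitalCStarAlgebra D]
    [PartialOrder D] [NormedAddCommGroup E] [NormedSpace ℂ E] [SMul Dᵐᵒᵖ E]
    [InnerProductModule D E] (L : LeftAction A D E) (v : X → E) (K : X → X → A →L[ℂ] D) : Prop :=
  ∀ x y a, K x y a = ip (v x) (L.hom a (v y))

/-- The vector coherent state `|x, a⟩ = ∑ a F_k(x) ⊗ φ_k` in `E ⊗ G`. -/
def mvcs {A B : Type*} (C : Type*) {E G X : Type*} [CStarAlgebra A]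
    [CStarAlgebra B] [PartialOrder B] [StarOrderedRing B]
    [CStarAlgebra C] [PartialOrder C] [StarOrderedRing C]
    [NormedAddCommGroup E] [NormedSpace ℂ E] [SMul Bᵐᵒᵖ E] [InnerProductModule B E]
    [NormedAddCommGroup G] [NormedSpace ℂ G] [SMul Cᵐᵒᵖ G] [InnerProductModule C G]
    (ρ : LeftAction A B E) (N : ℕ∞) (F : ℕ → X → E) (φ : ℕ → G) (x : X) (a : A) :
    ExtTensor B C E G :=
  limUnder atTop (partialSum N fun k => extTmul B C (ρ.hom a (F k x)) (φ k))

end Kernels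

end

open InnerProductModule

/-! Write `k_x` for the sum of the series at `a = 1`. The left action is contractive and `a(e ⊗ g) =
ae ⊗ g`, so the convergent series at `1` is carried by `a` to the series at `a`; hence all the
series converge and `|x,a⟩ = a k_x`. The kernel is then forced to be `K(x,y)[a] = ⟨k_x | a k_y⟩`: it
satisfies the formula because `a` has adjoint `a*`, and it is unique because every `a` equals `1*
a`. Complete positivity holds because the double sum is the square `⟨h | h⟩` of `h = ∑ a_i k_{x_i}
d_i`.

The substance is the reproducing property, which comes from a weak resolution of the identity, `∫ ⟨u
| k_y⟩ ⟨k_y | w⟩ dμ(y) = ⟨u | w⟩`, applied to `u = b* a k_x` and `w = b* a' k_z`; then `b b* = 1`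
removes `b`. For the finite sums `S_n(y) = ∑ F_k(y) ⊗ φ_k` the biorthogonality of the `F_k` gives `∫
⟨u | S_n⟩ ⟨S_n | w⟩ = ⟨u | P_n w⟩` with `P_n = 1 ⊗ ∑ |φ_k⟩⟨φ_k|`
(`integral_ip_mul_ip_eq_extFrameOp`). The reconstruction formula for the `φ_k` implies Bessel's
inequality for partial sums, so the `P_n` are contractions (`norm_frameOp_le`) and tend strongly to
the identity (`tendsto_extFrameOp`).

The limit has to pass under the integral. The integrals of `⟨S_n - S_m | w⟩* ⟨S_n - S_m | w⟩` are
`⟨w | (P_n - P_m) w⟩` and tend to zero in norm. This controls the norm of an integral, not an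
integral of norms, so Bochner convergence is out of reach. A Cauchy-Schwarz estimate with the norm
outside the integral (`integral_norm_apply_star_mul_le`) turns it into convergence in mean after
applying a functional, uniformly on the unit ball of the dual. That is exactly enough for a Pettis
integral (`hasPettisIntegral_of_tendsto`, `hasPettisIntegral_star_mul`). -/

noncomputable section

/-! ### Pettis integrals of products via an algebra-valued Cauchy-Schwarz estimate -/

section PettisIntegrals

variable {D X : Type*} [NonUnitalCStarAlgebra D] [MeasurableSpace X] {μ : Measure X}

/-- Reduces mixed products to positive elements, to which order estimates apply. -/
theorem star_mul_polarization (a b : D) :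
    (4 : ℂ) • (star a * b) = star (a + b) * (a + b)
      - star (a + (-1 : ℂ) • b) * (a + (-1 : ℂ) • b)
      - Complex.I • (star (a + Complex.I • b) * (a + Complex.I • b))
      + Complex.I • (star (a + (-Complex.I) • b) * (a + (-Complex.I) • b)) := by
  simp only [star_add, star_smul, add_mul, mul_add, smul_mul_assoc, mul_smul_comm, smul_add,
    smul_smul, RCLike.star_def, Complex.conj_I, map_neg, map_one, neg_neg]
  have h : Complex.I * Complex.I = -1 := Complex.I_mul_I
  simp only [mul_neg, neg_mul, h, mul_one, neg_neg]
  module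

theorem MeasureTheory.MemLp.integrable_star_mul {p q : X → D} (hp : MemLp p 2 μ)
    (hq : MemLp q 2 μ) : Integrable (fun y => star (p y) * q y) μ := by
  refine (hp.norm.integrable_mul hq.norm).mono
    (hp.aestronglyMeasurable.star.mul hq.aestronglyMeasurable) (ae_of_all _ fun y => ?_)
  simpa using norm_mul_le (star (p y)) (q y)

theorem MeasureTheory.MemLp.bounded_smul {p : X → D} (hp : MemLp p 2 μ)
    {c : X → ℂ} (hc : AEStronglyMeasurable c μ) (hc1 : ∀ y, ‖c y‖ ≤ 1) :
    MemLp (fun y => c y • p y) 2 μ :=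
  hp.mono (hc.smul hp.aestronglyMeasurable) (ae_of_all _ fun y => by
    rw [norm_smul]
    exact mul_le_of_le_one_left (norm_nonneg _) (hc1 y))

/-- The Cauchy condition is uniform over the unit ball of the dual. Fatou's lemma extends it to the
pointwise limit `g`, and Hahn-Banach makes the integrals of `f n` over any fixed set a norm Cauchy
sequence; its limit is the Pettis integral over that set. -/
theorem hasPettisIntegral_of_tendsto {V : Type*} [NormedAddCommGroup V] [NormedSpace ℂ V]
    [CompleteSpace V] {f : ℕ → X → V} {g : X → V} (hf : ∀ n, Integrable (f n) μ)
    (hlim : ∀ y, Tendsto (fun n => f n y) atTop (𝓝 (g y)))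
    (hcauchy : ∀ ε > 0, ∃ M, ∀ m ≥ M, ∀ n ≥ M, ∀ ψ : V →L[ℂ] ℂ,
      ∫ y, ‖ψ (f n y - f m y)‖ ∂μ ≤ ‖ψ‖ * ε) {v : V}
    (hv : Tendsto (fun n => ∫ y, f n y ∂μ) atTop (𝓝 v)) : HasPettisIntegral g μ v := by
  have hψ : ∀ ε > 0, ∃ M, ∀ m ≥ M, ∀ ψ : V →L[ℂ] ℂ,
      Integrable (fun y => ψ (g y - f m y)) μ ∧ ∫ y, ‖ψ (g y - f m y)‖ ∂μ ≤ ‖ψ‖ * ε := by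
    intro ε hε
    obtain ⟨M, hM⟩ := hcauchy ε hε
    refine ⟨M, fun m hm ψ => ?_⟩
    have hi : ∀ n, Integrable (fun y => ψ (f n y - f m y)) μ := fun n =>
      ψ.integrable_comp ((hf n).sub (hf m))
    have ht : ∀ y, Tendsto (fun n => ψ (f n y - f m y)) atTop (𝓝 (ψ (g y - f m y))) := fun y =>
      (ψ.continuous.tendsto _).comp ((hlim y).sub_const _)
    have hmeas : AEStronglyMeasurable (fun y => ψ (g y - f m y)) μ :=
      aestronglyMeasurable_of_tendsto_ae atTop (fun n => (hi n).aestronglyMeasurable)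
        (ae_of_all _ ht)
    -- Fatou gives integrability of the limit and the bound at once.
    have hfatou : ∫⁻ y, ‖ψ (g y - f m y)‖ₑ ∂μ ≤ ENNReal.ofReal (‖ψ‖ * ε) := by
      have hle : ∀ y, ‖ψ (g y - f m y)‖ₑ ≤ liminf (fun n => ‖ψ (f n y - f m y)‖ₑ) atTop :=
        fun y => (ht y).enorm.liminf_eq.ge
      refine (lintegral_mono hle).trans ((lintegral_liminf_le'
        fun n => (hi n).aestronglyMeasurable.enorm).trans ?_)
      refine liminf_le_of_frequently_le' (Eventually.frequently ?_)
      filter_upwards [eventually_ge_atTop M] with n hn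
      rw [← ofReal_integral_norm_eq_lintegral_enorm (hi n)]
      exact ENNReal.ofReal_le_ofReal (hM m hm n hn ψ)
    have hint : Integrable (fun y => ψ (g y - f m y)) μ :=
      ⟨hmeas, hfatou.trans_lt ENNReal.ofReal_lt_top⟩
    refine ⟨hint, ?_⟩
    rw [← ofReal_integral_norm_eq_lintegral_enorm hint] at hfatou
    exact (ENNReal.ofReal_le_ofReal_iff (by positivity)).1 hfatou
  have hgi : ∀ ψ : V →L[ℂ] ℂ, Integrable (fun y => ψ (g y)) μ := fun ψ => by
    obtain ⟨M, hM⟩ := hψ 1 one_pos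
    have := (hM M le_rfl ψ).1.add (ψ.integrable_comp (hf M))
    simpa [Pi.add_def] using this
  have hset : ∀ ε > 0, ∃ M, ∀ m ≥ M, ∀ (ψ : V →L[ℂ] ℂ) (s : Set X), 
      ‖∫ y in s, ψ (g y) ∂μ - ψ (∫ y in s, f m y ∂μ)‖ ≤ ‖ψ‖ * ε := by
    intro ε hε
    obtain ⟨M, hM⟩ := hψ ε hε
    refine ⟨M, fun m hm ψ s => ?_⟩
    rw [← ψ.integral_comp_comm (hf m).restrict, ← integral_sub (hgi ψ).restrict
      (ψ.integrable_comp (hf m).restrict)]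
    simp only [← map_sub]
    refine (norm_integral_le_integral_norm _).trans (le_trans ?_ (hM m hm ψ).2)
    exact setIntegral_le_integral (hM m hm ψ).1.norm (ae_of_all _ fun y => norm_nonneg _)
  -- The norm is tested on functionals, and both integrals are compared with the scalar integral of
  -- `ψ ∘ g`.
  have hJ : ∀ s : Set X, ∃ w, Tendsto (fun n => ∫ y in s, f n y ∂μ) atTop (𝓝 w) := fun s => by
    refine cauchySeq_tendsto_of_complete (Metric.cauchySeq_iff.2 fun ε hε => ?_)
    obtain ⟨M, hM⟩ := hset (ε / 3) (by positivity)
    refine ⟨M, fun m hm n hn => ?_⟩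
    rw [dist_eq_norm]
    refine lt_of_le_of_lt (NormedSpace.norm_le_dual_bound ℂ _
      (M := ε / 3 + ε / 3) (by positivity) fun ψ => ?_) (by linarith)
    have h1 := hM m hm ψ s
    have h2 := hM n hn ψ s
    calc ‖ψ (∫ y in s, f m y ∂μ - ∫ y in s, f n y ∂μ)‖
        = ‖(∫ y in s, ψ (g y) ∂μ - ψ (∫ y in s, f n y ∂μ))
          - (∫ y in s, ψ (g y) ∂μ - ψ (∫ y in s, f m y ∂μ))‖ := by rw [map_sub]; congr 1; abel
      _ ≤ ‖ψ‖ * (ε / 3) + ‖ψ‖ * (ε / 3) := (norm_sub_le _ _).trans (add_le_add h2 h1)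
      _ = (ε / 3 + ε / 3) * ‖ψ‖ := by ring
  choose J hJ using hJ
  refine ⟨hgi, J, tendsto_nhds_unique (hJ Set.univ) (by simpa using hv), fun s _ ψ => ?_⟩
  have h1 : Tendsto (fun n => ψ (∫ y in s, f n y ∂μ)) atTop (𝓝 (ψ (J s))) :=
    (ψ.continuous.tendsto _).comp (hJ s)
  refine tendsto_nhds_unique (Metric.tendsto_atTop.2 fun ε hε => ?_) h1
  obtain ⟨M, hM⟩ := hset (ε / (‖ψ‖ + 1)) (by positivity)
  refine ⟨M, fun m hm => ?_⟩
  rw [dist_comm, dist_eq_norm]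
  refine (hM m hm ψ s).trans_lt ?_
  rw [mul_div_assoc', div_lt_iff₀ (by positivity)]
  nlinarith [norm_nonneg ψ]

variable [PartialOrder D] [StarOrderedRing D]

/-- The difference of the two sides is `(a - b)* (a - b)`. -/
theorem star_add_mul_add_le (a b : D) :
    star (a + b) * (a + b) ≤ (2 : ℝ) • (star a * a + star b * b) := by
  have h := star_mul_self_nonneg (a - b)
  rw [← sub_nonneg]
  convert h using 1
  simp only [star_add, star_sub, two_smul]
  noncomm_ring

/-- The pointwise operator inequality is integrated first; norms are taken only afterwards, by their
monotonicity on positive elements. This keeps the norm outside the integral. -/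
theorem norm_integral_star_add_mul_add_le {p q : X → D} (hp : MemLp p 2 μ) (hq : MemLp q 2 μ)
    {c : X → ℂ} (hc1 : ∀ y, ‖c y‖ ≤ 1) :
    ‖∫ y, star (p y + c y • q y) * (p y + c y • q y) ∂μ‖
      ≤ 2 * (‖∫ y, star (p y) * p y ∂μ‖ + ‖∫ y, star (q y) * q y ∂μ‖) := by
  have hip := hp.integrable_star_mul hp
  have hiq := hq.integrable_star_mul hq
  have hle : ∀ y, star (p y + c y • q y) * (p y + c y • q y)
      ≤ (2 : ℝ) • (star (p y) * p y + star (q y) * q y) := fun y => by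
    refine (star_add_mul_add_le _ _).trans (smul_le_smul_of_nonneg_left ?_ two_pos.le)
    refine add_le_add le_rfl ?_
    have h1 : star (c y • q y) * (c y • q y) = (‖c y‖ ^ 2 : ℝ) • (star (q y) * q y) := by
      rw [star_smul, smul_mul_smul_comm, RCLike.star_def, Complex.conj_mul', ← Complex.coe_smul]
      norm_cast
    rw [h1]
    have h2 : (‖c y‖ ^ 2 : ℝ) ≤ 1 := pow_le_one₀ (norm_nonneg _) (hc1 y)
    simpa using smul_le_smul_of_nonneg_right h2 (star_mul_self_nonneg (q y))
  have hle2 : ∫ y, star (p y + c y • q y) * (p y + c y • q y) ∂μ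
      ≤ (2 : ℝ) • (∫ y, star (p y) * p y ∂μ + ∫ y, star (q y) * q y ∂μ) := by
    rw [← integral_add hip hiq, ← integral_smul]
    exact integral_mono_of_nonneg (ae_of_all _ fun y => star_mul_self_nonneg _)
      ((hip.add hiq).smul (2 : ℝ)) (ae_of_all _ hle)
  refine (CStarAlgebra.norm_le_norm_of_nonneg_of_le
    (integral_nonneg fun y => star_mul_self_nonneg _) hle2).trans ?_
  rw [norm_smul, Real.norm_ofNat]
  gcongr
  exact norm_add_le _ _

/-- The Cauchy-Schwarz inequality for algebra valued functions, up to a constant. -/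
theorem norm_integral_smul_star_mul_le {p q : X → D} (hp : MemLp p 2 μ) (hq : MemLp q 2 μ)
    {c : X → ℂ} (hc : AEStronglyMeasurable c μ) (hc1 : ∀ y, ‖c y‖ ≤ 1) :
    ‖∫ y, c y • (star (p y) * q y) ∂μ‖
      ≤ 2 * (‖∫ y, star (p y) * p y ∂μ‖ + ‖∫ y, star (q y) * q y ∂μ‖) := by
  set M := ‖∫ y, star (p y) * p y ∂μ‖ + ‖∫ y, star (q y) * q y ∂μ‖
  -- Used for the four fourth roots of unity `d`, the coefficients in the polarization of `p` and `c
  -- q`.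
  have hd : ∀ d : ℂ, ‖d‖ ≤ 1 →
      Integrable (fun y => star (p y + (d * c y) • q y) * (p y + (d * c y) • q y)) μ ∧
      ‖∫ y, star (p y + (d * c y) • q y) * (p y + (d * c y) • q y) ∂μ‖ ≤ 2 * M := fun d hd => by
    have h1 : AEStronglyMeasurable (fun y => d * c y) μ := hc.const_mul d
    have h2 : ∀ y, ‖d * c y‖ ≤ 1 := fun y => by
      rw [norm_mul]
      exact mul_le_one₀ hd (norm_nonneg _) (hc1 y)
    have h3 := hp.add (hq.bounded_smul h1 h2)
    exact ⟨h3.integrable_star_mul h3, norm_integral_star_add_mul_add_le hp hq h2⟩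
  obtain ⟨i1, n1⟩ := hd 1 (by simp)
  obtain ⟨i2, n2⟩ := hd (-1) (by simp)
  obtain ⟨i3, n3⟩ := hd Complex.I (by simp)
  obtain ⟨i4, n4⟩ := hd (-Complex.I) (by simp)
  have key : (4 : ℂ) • ∫ y, c y • (star (p y) * q y) ∂μ =
      ∫ y, star (p y + ((1 : ℂ) * c y) • q y) * (p y + ((1 : ℂ) * c y) • q y) ∂μ
      - ∫ y, star (p y + ((-1 : ℂ) * c y) • q y) * (p y + ((-1 : ℂ) * c y) • q y) ∂μ
      - Complex.I • ∫ y, star (p y + (Complex.I * c y) • q y) * (p y + (Complex.I * c y) • q y) ∂μ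
      + Complex.I •
        ∫ y, star (p y + ((-Complex.I) * c y) • q y) * (p y + ((-Complex.I) * c y) • q y) ∂μ := by
    rw [← integral_smul, ← integral_smul, ← integral_smul, ← integral_sub i1 i2,
      ← integral_sub, ← integral_add]
    · refine integral_congr_ae (ae_of_all _ fun y => ?_)
      have h := star_mul_polarization (p y) (c y • q y)
      simp only [smul_smul, mul_smul_comm] at h
      simpa only [smul_smul, one_mul] using h
    · exact (i1.sub i2).sub (i3.smul Complex.I)
    · exact i4.smul Complex.I
    · exact i1.sub i2
    · exact i3.smul Complex.I
  -- Four terms of size `2 M` against the factor `4` leave the constant `2`.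
  have h4 : 4 * ‖∫ y, c y • (star (p y) * q y) ∂μ‖ ≤ 2 * M + 2 * M + 2 * M + 2 * M := by
    have := congrArg norm key
    rw [norm_smul, Complex.norm_ofNat] at this
    rw [this]
    refine (norm_add_le _ _).trans (add_le_add ((norm_sub_le _ _).trans
      (add_le_add ((norm_sub_le _ _).trans (add_le_add n1 n2)) ?_)) ?_)
    · rwa [norm_smul, Complex.norm_I, one_mul]
    · rwa [norm_smul, Complex.norm_I, one_mul]
  linarith

/-- Multiplying by a measurable phase makes the integrand of `ψ` nonnegative, so `ψ` can be pulled
out of one vector integral that the preceding estimate bounds. -/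
theorem integral_norm_apply_star_mul_le_add {p q : X → D} (hp : MemLp p 2 μ) (hq : MemLp q 2 μ)
    (ψ : D →L[ℂ] ℂ) :
    ∫ y, ‖ψ (star (p y) * q y)‖ ∂μ
      ≤ ‖ψ‖ * (2 * (‖∫ y, star (p y) * p y ∂μ‖ + ‖∫ y, star (q y) * q y ∂μ‖)) := by
  -- The conjugate phase; where `ψ` vanishes, division by zero gives `c = 0`, which is harmless.
  set c : X → ℂ := fun y => star (ψ (star (p y) * q y)) / ‖ψ (star (p y) * q y)‖ with hcdef
  have hi := hp.integrable_star_mul hq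
  have hm : AEStronglyMeasurable (fun y => ψ (star (p y) * q y)) μ :=
    (ψ.integrable_comp hi).aestronglyMeasurable
  have hc : AEStronglyMeasurable c μ := by
    have h1 : AEMeasurable (fun y => ψ (star (p y) * q y)) μ := hm.aemeasurable
    have h2 : Measurable fun z : ℂ => star z / (‖z‖ : ℂ) :=
      continuous_star.measurable.div (Complex.measurable_ofReal.comp measurable_norm)
    exact (h2.comp_aemeasurable h1).aestronglyMeasurable
  have hc1 : ∀ y, ‖c y‖ ≤ 1 := fun y => by
    rw [hcdef]
    simp only [norm_div, norm_star, Complex.norm_real, norm_norm]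
    exact div_self_le_one _
  have hmul : ∀ y, ((‖ψ (star (p y) * q y)‖ : ℝ) : ℂ) = ψ (c y • (star (p y) * q y)) := fun y => by
    rw [map_smul, smul_eq_mul, hcdef]
    simp only [RCLike.star_def]
    rw [div_mul_eq_mul_div, Complex.conj_mul']
    by_cases h : ψ (star (p y) * q y) = 0
    · simp [h]
    · field_simp
  have hci : Integrable (fun y => c y • (star (p y) * q y)) μ := by
    have h := hp.integrable_star_mul (hq.bounded_smul hc hc1)
    simpa only [mul_smul_comm] using h
  have h1 : ((∫ y, ‖ψ (star (p y) * q y)‖ ∂μ : ℝ) : ℂ)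
      = ψ (∫ y, c y • (star (p y) * q y) ∂μ) := by
    rw [← integral_complex_ofReal, ← ψ.integral_comp_comm hci]
    simp only [hmul]
  have h0 : 0 ≤ ∫ y, ‖ψ (star (p y) * q y)‖ ∂μ := integral_nonneg fun y => norm_nonneg _
  rw [← abs_of_nonneg h0, ← Real.norm_eq_abs, ← Complex.norm_real, h1]
  exact (ψ.le_opNorm _).trans (mul_le_mul_of_nonneg_left
    (norm_integral_smul_star_mul_le hp hq hc hc1) (norm_nonneg _))

/-- Rescaling `p` by `r` and `q` by `r⁻¹` leaves the product unchanged. The free `r` replaces the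
geometric mean of the usual Cauchy-Schwarz inequality: one small factor suffices when the other is
bounded. -/
theorem integral_norm_apply_star_mul_le {p q : X → D} (hp : MemLp p 2 μ) (hq : MemLp q 2 μ)
    (ψ : D →L[ℂ] ℂ) {r : ℝ} (hr : 0 < r) :
    ∫ y, ‖ψ (star (p y) * q y)‖ ∂μ
      ≤ ‖ψ‖ * (2 * (r ^ 2 * ‖∫ y, star (p y) * p y ∂μ‖
        + r⁻¹ ^ 2 * ‖∫ y, star (q y) * q y ∂μ‖)) := by
  have h := integral_norm_apply_star_mul_le_add (hp.const_smul r) (hq.const_smul r⁻¹) ψ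
  simp only [Pi.smul_apply, star_smul, star_trivial, smul_mul_smul_comm, integral_smul, norm_smul,
    mul_inv_cancel₀ hr.ne', one_smul, norm_mul, Real.norm_eq_abs, abs_of_pos hr,
    abs_of_pos (inv_pos.2 hr)] at h
  simpa only [sq] using h

/-- The Cauchy condition follows from `p_n* q_n - p_m* q_m = (p_n - p_m)* q_n + p_m* (q_n - q_m)`,
where each summand has one small and one bounded factor. -/
theorem hasPettisIntegral_star_mul {p q : ℕ → X → D} {p' q' : X → D}
    (hp : ∀ n, MemLp (p n) 2 μ) (hq : ∀ n, MemLp (q n) 2 μ)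
    (hp' : ∀ y, Tendsto (fun n => p n y) atTop (𝓝 (p' y)))
    (hq' : ∀ y, Tendsto (fun n => q n y) atTop (𝓝 (q' y))) {R : ℝ}
    (hpR : ∀ n, ‖∫ y, star (p n y) * p n y ∂μ‖ ≤ R)
    (hqR : ∀ n, ‖∫ y, star (q n y) * q n y ∂μ‖ ≤ R)
    (hpc : ∀ ε > 0, ∃ M, ∀ m ≥ M, ∀ n ≥ m,
      ‖∫ y, star (p n y - p m y) * (p n y - p m y) ∂μ‖ ≤ ε)
    (hqc : ∀ ε > 0, ∃ M, ∀ m ≥ M, ∀ n ≥ m,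
      ‖∫ y, star (q n y - q m y) * (q n y - q m y) ∂μ‖ ≤ ε) {v : D}
    (hv : Tendsto (fun n => ∫ y, star (p n y) * q n y ∂μ) atTop (𝓝 v)) :
    HasPettisIntegral (fun y => star (p' y) * q' y) μ v := by
  have hR : 0 ≤ R := (norm_nonneg _).trans (hpR 0)
  refine hasPettisIntegral_of_tendsto (fun n => (hp n).integrable_star_mul (hq n))
    (fun y => (hp' y).star.mul (hq' y)) (fun ε hε => ?_) hv
  -- `r` is fixed first, large enough that the bounded factor contributes at most `ε / 4`; `R + 1`
  -- keeps it positive when `R = 0`. The tolerance `ε / (8 r²)` then gives the small factor `ε / 4`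
  -- too.
  obtain ⟨r, hr, hrR⟩ : ∃ r : ℝ, 0 < r ∧ 2 * (r⁻¹ ^ 2 * R) ≤ ε / 4 := by
    refine ⟨Real.sqrt (8 * (R + 1) / ε), by positivity, ?_⟩
    rw [inv_pow, Real.sq_sqrt (by positivity), inv_div, div_mul_eq_mul_div, mul_div_assoc',
      div_le_iff₀ (by positivity)]
    nlinarith
  have hδ : 0 < ε / (8 * r ^ 2) := by positivity
  have hδ2 : 2 * (r ^ 2 * (ε / (8 * r ^ 2))) = ε / 4 := by field_simp; norm_num
  obtain ⟨M1, hM1⟩ := hpc _ hδ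
  obtain ⟨M2, hM2⟩ := hqc _ hδ
  have key : ∀ m ≥ max M1 M2, ∀ n ≥ m, ∀ ψ : D →L[ℂ] ℂ,
      ∫ y, ‖ψ (star (p n y) * q n y - star (p m y) * q m y)‖ ∂μ ≤ ‖ψ‖ * ε := by
    intro m hm n hn ψ
    have hpd := (hp n).sub (hp m)
    have hqd := (hq n).sub (hq m)
    have b1 := integral_norm_apply_star_mul_le hpd (hq n) ψ hr
    -- Here the small factor is the second one, so the roles of `r` and `r⁻¹` are exchanged.
    have b2 := integral_norm_apply_star_mul_le (hp m) hqd ψ (inv_pos.2 hr)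
    have e1 := hM1 m ((le_max_left _ _).trans hm) n hn
    have e2 := hM2 m ((le_max_right _ _).trans hm) n hn
    rw [inv_inv] at b2
    simp only [Pi.sub_apply] at b1 b2
    have i1 : Integrable (fun y => ψ (star (p n y - p m y) * q n y)) μ :=
      ψ.integrable_comp (hpd.integrable_star_mul (hq n))
    have i2 : Integrable (fun y => ψ (star (p m y) * (q n y - q m y))) μ :=
      ψ.integrable_comp ((hp m).integrable_star_mul hqd)
    have hs : ∫ y, ‖ψ (star (p n y) * q n y - star (p m y) * q m y)‖ ∂μ
        ≤ ∫ y, ‖ψ (star (p n y - p m y) * q n y)‖ ∂μ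
          + ∫ y, ‖ψ (star (p m y) * (q n y - q m y))‖ ∂μ := by
      rw [← integral_add i1.norm i2.norm]
      refine integral_mono_of_nonneg (ae_of_all _ fun y => norm_nonneg _) (i1.norm.add i2.norm)
        (ae_of_all _ fun y => ?_)
      refine le_trans (le_of_eq ?_) (norm_add_le _ _)
      rw [← map_add, star_sub, sub_mul, mul_sub, sub_add_sub_cancel]
    have f1 : 2 * (r ^ 2 * ‖∫ y, star (p n y - p m y) * (p n y - p m y) ∂μ‖
        + r⁻¹ ^ 2 * ‖∫ y, star (q n y) * q n y ∂μ‖) ≤ ε / 2 := by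
      have g1 := mul_le_mul_of_nonneg_left e1 (sq_nonneg r)
      have g2 := mul_le_mul_of_nonneg_left (hqR n) (sq_nonneg r⁻¹)
      linarith
    have f2 : 2 * (r⁻¹ ^ 2 * ‖∫ y, star (p m y) * p m y ∂μ‖
        + r ^ 2 * ‖∫ y, star (q n y - q m y) * (q n y - q m y) ∂μ‖) ≤ ε / 2 := by
      have g1 := mul_le_mul_of_nonneg_left e2 (sq_nonneg r)
      have g2 := mul_le_mul_of_nonneg_left (hpR m) (sq_nonneg r⁻¹)
      linarith
    have f3 := mul_le_mul_of_nonneg_left f1 (norm_nonneg ψ)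
    have f4 := mul_le_mul_of_nonneg_left f2 (norm_nonneg ψ)
    linarith
  refine ⟨max M1 M2, fun m hm n hn ψ => ?_⟩
  rcases le_total m n with h | h
  · exact key m hm n h ψ
  · simpa only [map_sub, norm_sub_rev] using key n hn m h ψ

end PettisIntegrals

/-! ### Cauchy-Schwarz and square integrable functions in inner product modules -/

namespace InnerProductModule

section CauchySchwarz

variable {D H : Type*} [NonUnitalCStarAlgebra D] [PartialOrder D]
  [NormedAddCommGroup H] [NormedSpace ℂ H] [SMul Dᵐᵒᵖ H] [InnerProductModule D H]

theorem ip_sub_left (x y z : H) : ip (B := D) (x - y) z = ip x z - ip y z := by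
  rw [← star_ip, ip_sub_right, star_sub, star_ip, star_ip]

theorem norm_op_smul_le (x : H) (b : D) : ‖x <• b‖ ≤ ‖x‖ * ‖b‖ := by
  refine (sq_le_sq₀ (norm_nonneg _) (by positivity)).1 ?_
  rw [norm_sq_eq (B := D), ip_op_smul_left, ip_op_smul_right, mul_pow, norm_sq_eq (B := D) x]
  refine (norm_mul_le _ _).trans ((mul_le_mul_of_nonneg_left (norm_mul_le _ _)
    (norm_nonneg _)).trans_eq ?_)
  rw [norm_star]
  ring

variable (D H) in
/-- The right action as a bounded bilinear map. -/
def opSMulL : H →L[ℂ] D →L[ℂ] H :=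
  LinearMap.mkContinuous₂
    (LinearMap.mk₂ ℂ (fun (x : H) (b : D) => x <• b) add_op_smul smul_op_smul op_add_smul
      op_smul_smul) 1
    fun x b => by simpa using norm_op_smul_le x b

variable [StarOrderedRing D]

/-- Expand `0 ≤ ⟨y - x b | y - x b⟩` with `b = ⟨x | y⟩`, and use `b* ⟨x | x⟩ b ≤ b* b`, which holds
since `‖⟨x | x⟩‖ = ‖x‖² ≤ 1`. -/
theorem star_ip_mul_ip_le {x : H} (hx : ‖x‖ ≤ 1) (y : H) :
    star (ip (B := D) x y) * ip x y ≤ ip y y := by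
  set b : D := ip x y with hb
  have h := ip_self_nonneg (B := D) (y - x <• b)
  rw [ip_sub_left, ip_op_smul_left, ip_sub_right, ip_sub_right, ip_op_smul_right, ip_op_smul_right,
    ← star_ip x y, ← hb, mul_sub, ← mul_assoc] at h
  have hsa : IsSelfAdjoint (ip (B := D) x x) := star_ip x x
  have h1 : star b * ip x x * b ≤ star b * b := by
    refine (CStarAlgebra.star_left_conjugate_le_norm_smul (a := b) hsa).trans ?_
    rw [← norm_sq_eq]
    simpa using smul_le_smul_of_nonneg_right (pow_le_one₀ (n := 2) (norm_nonneg x) hx)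
      (star_mul_self_nonneg b)
  have h2 : ip (B := D) y y - star b * b - (star b * b - star b * ip x x * b)
      ≤ ip y y - star b * b := sub_le_self _ (sub_nonneg.2 h1)
  exact sub_nonneg.1 (h.trans h2)

theorem norm_ip_le (x y : H) : ‖ip (B := D) x y‖ ≤ ‖x‖ * ‖y‖ := by
  have key : ∀ x : H, ‖x‖ ≤ 1 → ‖ip (B := D) x y‖ ≤ ‖y‖ := fun x hx => by
    have h := CStarAlgebra.norm_le_norm_of_nonneg_of_le (star_mul_self_nonneg _)
      (star_ip_mul_ip_le (D := D) hx y)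
    rw [CStarRing.norm_star_mul_self, ← norm_sq_eq, ← sq] at h
    exact (sq_le_sq₀ (norm_nonneg _) (norm_nonneg _)).1 h
  rcases eq_or_ne x 0 with rfl | hx
  · simp [ip_zero_left]
  · have h0 : 0 < ‖x‖ := norm_pos_iff.2 hx
    have h := key ((‖x‖⁻¹ : ℂ) • x) (by
      rw [norm_smul, norm_inv, Complex.norm_real, norm_norm, inv_mul_cancel₀ h0.ne'])
    rw [ip_smul_left, norm_smul, norm_star, norm_inv, Complex.norm_real, norm_norm,
      inv_mul_le_iff₀ h0] at h
    exact h

variable (D H) in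
/-- The inner product as a bounded sesquilinear map. -/
def ipSL : H →L⋆[ℂ] H →L[ℂ] D :=
  LinearMap.mkContinuous₂
    (LinearMap.mk₂'ₛₗ (starRingEnd ℂ) (RingHom.id ℂ) (fun x y : H => ip (B := D) x y)
      ip_add_left ip_smul_left ip_add_right ip_smul_right) 1
    fun x y => by simpa using norm_ip_le (D := D) x y

theorem ipSL_apply (x y : H) : ipSL D H x y = ip x y := rfl

theorem continuous_ip : Continuous fun z : H × H => ip (B := D) z.1 z.2 :=
  ((ipSL D H).continuous.comp continuous_fst).clm_apply continuous_snd

theorem ip_sum_right {ι : Type*} (s : Finset ι) (x : H) (y : ι → H) :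
    ip (B := D) x (∑ i ∈ s, y i) = ∑ i ∈ s, ip x (y i) :=
  map_sum (ipSL D H x) y s

theorem ip_sum_left {ι : Type*} (s : Finset ι) (x : ι → H) (y : H) :
    ip (B := D) (∑ i ∈ s, x i) y = ∑ i ∈ s, ip (x i) y := by
  rw [← star_ip, ip_sum_right, star_sum]
  simp only [star_ip]

end CauchySchwarz

section SqIntegrable

variable {D H X : Type*} [NonUnitalCStarAlgebra D] [PartialOrder D]
  [NormedAddCommGroup H] [NormedSpace ℂ H] [SMul Dᵐᵒᵖ H] [InnerProductModule D H]
  [MeasurableSpace X] {μ : Measure X}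

theorem _root_.SqIntegrable.memLp {F : X → H} (hF : SqIntegrable D F μ) : MemLp F 2 μ := by
  refine (memLp_two_iff_integrable_sq_norm hF.1).2 ?_
  simpa only [norm_sq_eq (B := D)] using hF.2.norm

variable [StarOrderedRing D]

theorem memLp_ip_left {V : X → H} (hV : MemLp V 2 μ) (w : H) :
    MemLp (fun y => ip (B := D) (V y) w) 2 μ :=
  hV.of_le_mul (c := ‖w‖)
    ((continuous_ip.comp (Continuous.prodMk continuous_id continuous_const)).comp_aestronglyMeasurable
      hV.aestronglyMeasurable)
    (ae_of_all _ fun _ => (norm_ip_le _ _).trans_eq (mul_comm _ _))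

/-- Ensures that the integrals in the biorthogonality relation are genuine Bochner integrals, so
that bounded linear maps commute with them. -/
theorem integrable_op_smul_ip {V W : X → H} (hV : MemLp V 2 μ) (hW : MemLp W 2 μ) (e : H) :
    Integrable (fun y => V y <• ip (B := D) (W y) e) μ := by
  refine (hV.norm.integrable_mul (memLp_ip_left (D := D) hW e).norm).mono
    ((opSMulL D H).continuous₂.comp_aestronglyMeasurable
      (hV.aestronglyMeasurable.prodMk (memLp_ip_left (D := D) hW e).aestronglyMeasurable))
    (ae_of_all _ fun y => ?_)
  simpa using norm_op_smul_le (V y) (ip (B := D) (W y) e)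

variable (D) in
/-- The bounded map `w ↦ ∫ ⟨u | V⟩ ⟨V | w⟩`. -/
def integralIpMulIp (u : H) {V : X → H} (hV : MemLp V 2 μ) : H →L[ℂ] D :=
  have hi : ∀ w : H, Integrable (fun y => ip (B := D) u (V y) * ip (V y) w) μ := fun w => by
    simpa only [star_ip] using
      (memLp_ip_left (D := D) hV u).integrable_star_mul (memLp_ip_left (D := D) hV w)
  LinearMap.mkContinuous
    { toFun := fun w => ∫ y, ip (B := D) u (V y) * ip (V y) w ∂μ
      map_add' := fun w w' => by
        rw [← integral_add (hi w) (hi w')]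
        simp only [ip_add_right, mul_add]
      map_smul' := fun c w => by
        rw [RingHom.id_apply, ← integral_smul]
        simp only [ip_smul_right, mul_smul_comm] }
    (∫ y, ‖u‖ * ‖V y‖ ^ 2 ∂μ) fun w => by
      change ‖∫ y, ip (B := D) u (V y) * ip (V y) w ∂μ‖ ≤ _
      rw [← integral_mul_const]
      refine norm_integral_le_of_norm_le
        (((memLp_two_iff_integrable_sq_norm hV.aestronglyMeasurable).1 hV |>.const_mul
          ‖u‖).mul_const ‖w‖) (ae_of_all _ fun y => (norm_mul_le _ _).trans ?_)
      calc ‖ip (B := D) u (V y)‖ * ‖ip (B := D) (V y) w‖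
          ≤ (‖u‖ * ‖V y‖) * (‖V y‖ * ‖w‖) :=
            mul_le_mul (norm_ip_le _ _) (norm_ip_le _ _) (norm_nonneg _) (by positivity)
        _ = ‖u‖ * ‖V y‖ ^ 2 * ‖w‖ := by ring

theorem integralIpMulIp_apply (u : H) {V : X → H} (hV : MemLp V 2 μ) (w : H) :
    integralIpMulIp D u hV w = ∫ y, ip (B := D) u (V y) * ip (V y) w ∂μ := rfl

end SqIntegrable

end InnerProductModule

/-! ### Density of the generators in operator modules -/

section Density

variable {I : Type*} {𝓗 𝓚 : I → Type*}
  [∀ i, NormedAddCommGroup (𝓗 i)] [∀ i, InnerProductSpace ℂ (𝓗 i)] [∀ i, CompleteSpace (𝓗 i)]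
  [∀ i, NormedAddCommGroup (𝓚 i)] [∀ i, InnerProductSpace ℂ (𝓚 i)] [∀ i, CompleteSpace (𝓚 i)]
  {s : Set (OpFamily 𝓗 𝓗)} {t : Set (OpFamily 𝓗 𝓚)}

/-- The inclusion into the operator families is an isometry from a complete space, so it maps `K` to
a closed subspace; this contains the generators and hence their closed span. -/
theorem OpModule.mem_of_isClosed (K : Submodule ℂ (OpModule s t))
    (hK : IsClosed (K : Set (OpModule s t)))
    (h : ∀ T (hT : T ∈ t), OpModule.mk s T (subset_opSpan t hT) ∈ K) (w : OpModule s t) :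
    w ∈ K := by
  have hiso : Isometry (OpModule.val s t) :=
    AddMonoidHomClass.isometry_of_norm _ OpModule.norm_val
  have hcl : IsClosed ((K.map (OpModule.val s t).toLinearMap : Submodule ℂ (OpFamily 𝓗 𝓚)) :
      Set (OpFamily 𝓗 𝓚)) := hiso.isClosedEmbedding.isClosedMap _ hK
  have hle : opSpan t ≤ K.map (OpModule.val s t).toLinearMap :=
    Submodule.topologicalClosure_minimal _
      (Submodule.span_le.2 fun T hT => ⟨OpModule.mk s T (subset_opSpan t hT), h T hT, rfl⟩) hcl
  obtain ⟨w', hw', he⟩ := hle w.val_mem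
  exact OpModule.ext (s := s) he ▸ hw'

/-- The operator on the Hilbert module that is induced by a family of operators. -/
def OpModule.compL (R : OpFamily 𝓚 𝓚) (h : ∀ T ∈ t, opComp R T ∈ t) :
    OpModule s t →L[ℂ] OpModule s t :=
  LinearMap.mkContinuous
    { toFun := fun w => OpModule.mk s (opComp R (OpModule.val s t w))
        (clm_mem_closure_span (opCompLeft R) t (opSpan t) (isClosed_opSpan t)
          (fun T hT => subset_opSpan t (h T hT)) w.val_mem)
      map_add' := fun _ _ => OpModule.ext (opComp_add _ _ _)
      map_smul' := fun c _ => OpModule.ext (opComp_smul _ c _) } ‖R‖ fun w =>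
    opFamily_norm_comp_le R (OpModule.val s t w)

theorem OpModule.norm_compL_apply_le (R : OpFamily 𝓚 𝓚) (h : ∀ T ∈ t, opComp R T ∈ t)
    (w : OpModule s t) : ‖OpModule.compL R h w‖ ≤ ‖R‖ * ‖w‖ :=
  opFamily_norm_comp_le R (OpModule.val s t w)

end Density

theorem op_smul_one {C G : Type*} [CStarAlgebra C] [PartialOrder C] [NormedAddCommGroup G]
    [NormedSpace ℂ G] [SMul Cᵐᵒᵖ G] [InnerProductModule C G] (g : G) : g <• (1 : C) = g :=
  ext_ip (B := C) fun z => by rw [ip_op_smul_right, mul_one]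

/-! ### Frame operators on the exterior tensor product -/

section ExteriorTensor

variable {B C E G : Type*}
  [CStarAlgebra B] [PartialOrder B] [StarOrderedRing B]
  [CStarAlgebra C] [PartialOrder C] [StarOrderedRing C]
  [NormedAddCommGroup E] [NormedSpace ℂ E] [SMul Bᵐᵒᵖ E] [InnerProductModule B E]
  [NormedAddCommGroup G] [NormedSpace ℂ G] [SMul Cᵐᵒᵖ G] [InnerProductModule C G]

theorem ExtTensor.mem_of_isClosed (K : Submodule ℂ (ExtTensor B C E G))
    (hK : IsClosed (K : Set (ExtTensor B C E G))) (h : ∀ e g, extTmul B C e g ∈ K)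
    (w : ExtTensor B C E G) : w ∈ K := by
  refine OpModule.mem_of_isClosed K hK ?_ w
  rintro _ ⟨z, rfl⟩
  exact h z.1 z.2

theorem ExtTensor.clm_ext {W : Type*} [NormedAddCommGroup W] [NormedSpace ℂ W]
    {S T : ExtTensor B C E G →L[ℂ] W} (h : ∀ e g, S (extTmul B C e g) = T (extTmul B C e g)) :
    S = T := by
  ext w
  have hmem := ExtTensor.mem_of_isClosed (LinearMap.eqLocus S.toLinearMap T.toLinearMap)
    (isClosed_eq S.continuous T.continuous) h w
  exact hmem

variable (B C E G) in
/-- The elementary tensors as a bounded bilinear map. -/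
def extTmulL : E →L[ℂ] G →L[ℂ] ExtTensor B C E G :=
  LinearMap.mkContinuous₂
    (LinearMap.mk₂ ℂ (fun (e : E) (g : G) => extTmul B C e g)
      (fun e e' g => OpModule.ext (pairOp_add_left B C e e' g))
      (fun c e g => OpModule.ext (pairOp_smul_left B C c e g))
      (fun e g g' => OpModule.ext (pairOp_add_right B C e g g'))
      (fun c e g => OpModule.ext (pairOp_smul_right B C c e g))) 1
    fun e g => by simpa using norm_extTmul_le B C e g

/-- The operator `Σ |φ_k⟩⟨φ_k|` on the completion of `G`. -/
def frameOp (η : C →ₚ[ℂ] ℂ) (s : Finset ℕ) (φ : ℕ → G) : Loc η G →L[ℂ] Loc η G :=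
  ∑ k ∈ s, ket η (φ k) ∘L (ket η (φ k)).adjoint

/-- Termwise, `|φ⟩⟨φ| ∘ |g⟩ = |φ⟩ ∘ ⟨φ | g⟩ = |φ ⟨φ | g⟩⟩`, since `ket` turns inner products and
right multiplication into operator composition. -/
theorem frameOp_comp_ket (η : C →ₚ[ℂ] ℂ) (s : Finset ℕ) (φ : ℕ → G) (g : G) :
    frameOp η s φ ∘L ket η g = ket η (∑ k ∈ s, φ k <• ip (B := C) (φ k) g) := by
  let f : G →+ (Loc η C →L[ℂ] Loc η G) := AddMonoidHom.mk' (ket η) (ket_add η)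
  change _ = f _
  rw [map_sum, frameOp]
  refine loc_ext η fun c => ?_
  rw [ContinuousLinearMap.comp_apply, sum_apply, sum_apply]
  refine Finset.sum_congr rfl fun k _ => ?_
  change _ = ket η (φ k <• ip (B := C) (φ k) g) (toLoc η c)
  rw [← ket_comp_ket, ← adjoint_ket_comp_ket]
  rfl

theorem frameOp_toLoc (η : C →ₚ[ℂ] ℂ) (s : Finset ℕ) (φ : ℕ → G) (g : G) :
    frameOp η s φ (toLoc η g) = toLoc η (∑ k ∈ s, φ k <• ip (B := C) (φ k) g) := by
  have h : ∀ g : G, ket η g (toLoc η (1 : C)) = toLoc η g := fun g => by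
    rw [ket_coe, op_smul_one]
  rw [← h g, ← ContinuousLinearMap.comp_apply, frameOp_comp_ket, h]

/-- Bessel's inequality for the vectors `φ_k`, `k ∈ s`. -/
def IsBessel (C : Type*) {G : Type*} [NonUnitalCStarAlgebra C] [PartialOrder C]
    [NormedAddCommGroup G] [NormedSpace ℂ G] [SMul Cᵐᵒᵖ G] [InnerProductModule C G]
    (s : Finset ℕ) (φ : ℕ → G) : Prop :=
  ∀ g : G, ip (B := C) g (∑ k ∈ s, φ k <• ip (B := C) (φ k) g) ≤ ip g g

/-- A positive operator is a contraction as soon as its quadratic form is dominated by that of the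
identity. On the dense set of classes of `g ∈ G` this is Bessel's inequality with `η` applied to it.
-/
theorem norm_frameOp_le {s : Finset ℕ} {φ : ℕ → G} (hs : IsBessel C s φ) (η : C →ₚ[ℂ] ℂ) :
    ‖frameOp η s φ‖ ≤ 1 := by
  have hpos : 0 ≤ frameOp η s φ := Finset.sum_nonneg fun k _ => by
    rw [ContinuousLinearMap.nonneg_iff_isPositive]
    have := ContinuousLinearMap.isPositive_adjoint_comp_self (ket η (φ k)).adjoint
    rwa [ContinuousLinearMap.adjoint_adjoint] at this
  rw [CStarAlgebra.norm_le_one_iff_of_nonneg _ hpos, ← sub_nonneg,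
    ContinuousLinearMap.nonneg_iff_isPositive, ContinuousLinearMap.isPositive_iff_complex]
  have hsa : IsSelfAdjoint (1 - frameOp η s φ) :=
    (IsSelfAdjoint.one _).sub hpos.isSelfAdjoint
  intro x
  refine ⟨hsa.isSymmetric.coe_re_inner_apply_self x, ?_⟩
  refine (denseRange_toLoc η).induction_on x (isClosed_le continuous_const
    (Complex.continuous_re.comp (((1 - frameOp η s φ).continuous).inner continuous_id))) fun g => ?_
  rw [sub_apply, frameOp_toLoc, one_apply_eq_self, inner_sub_left, ← inner_conj_symm,
    ← inner_conj_symm (toLoc η (∑ k ∈ s, φ k <• ip (B := C) (φ k) g)), inner_toLoc, inner_toLoc,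
    ← map_sub, ← map_sub]
  have h := η.map_nonneg (sub_nonneg.2 (hs g))
  simpa using (Complex.nonneg_iff.1 h).1

/-- The operators `1 ⊗ Σ |φ_k⟩⟨φ_k|`. -/
def frameFamily (B E : Type*) [CStarAlgebra B] [PartialOrder B] [StarOrderedRing B]
    [NormedAddCommGroup E] [NormedSpace ℂ E] [SMul Bᵐᵒᵖ E] [InnerProductModule B E]
    {s : Finset ℕ} {φ : ℕ → G} (hs : IsBessel C s φ) :
    OpFamily (PairSpace (B := B) (C := C) E G) (PairSpace (B := B) (C := C) E G) :=
  opMk (fun p => HilbertTensor.map (ContinuousLinearMap.id ℂ _) (frameOp p.2 s φ)) 1 fun p =>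
    (HilbertTensor.norm_map_le _ _).trans
      (mul_le_one₀ ContinuousLinearMap.norm_id_le (norm_nonneg _) (norm_frameOp_le hs p.2))

theorem norm_frameFamily_le {s : Finset ℕ} {φ : ℕ → G} (hs : IsBessel C s φ) :
    ‖frameFamily B E hs‖ ≤ 1 :=
  opFamily_norm_le zero_le_one fun p => (HilbertTensor.norm_map_le _ _).trans
      (mul_le_one₀ ContinuousLinearMap.norm_id_le (norm_nonneg _) (norm_frameOp_le hs p.2))

theorem opComp_frameFamily_pairOp {s : Finset ℕ} {φ : ℕ → G} (hs : IsBessel C s φ) (e : E)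
    (g : G) : opComp (frameFamily B E hs) (pairOp B C e g)
      = pairOp B C e (∑ k ∈ s, φ k <• ip (B := C) (φ k) g) :=
  opFamily_ext fun p => by
    change HilbertTensor.map (ContinuousLinearMap.id ℂ (Loc p.1 E)) (frameOp p.2 s φ) ∘L
        HilbertTensor.map (ket p.1 e) (ket p.2 g)
      = HilbertTensor.map (ket p.1 e) (ket p.2 (∑ k ∈ s, φ k <• ip (B := C) (φ k) g))
    rw [HilbertTensor.map_comp, frameOp_comp_ket, ContinuousLinearMap.id_comp]

/-- The operator `1 ⊗ Σ |φ_k⟩⟨φ_k|` on the exterior tensor product. -/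
def extFrameOp (B E : Type*) [CStarAlgebra B] [PartialOrder B] [StarOrderedRing B]
    [NormedAddCommGroup E] [NormedSpace ℂ E] [SMul Bᵐᵒᵖ E] [InnerProductModule B E]
    {s : Finset ℕ} {φ : ℕ → G} (hs : IsBessel C s φ) :
    ExtTensor B C E G →L[ℂ] ExtTensor B C E G :=
  OpModule.compL (frameFamily B E hs) (by
    rintro _ ⟨z, rfl⟩
    rw [opComp_frameFamily_pairOp]
    exact pairOp_mem_elementary B C _ _)

theorem extFrameOp_extTmul {s : Finset ℕ} {φ : ℕ → G} (hs : IsBessel C s φ) (e : E) (g : G) :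
    extFrameOp B E hs (extTmul B C e g)
      = extTmul B C e (∑ k ∈ s, φ k <• ip (B := C) (φ k) g) :=
  OpModule.ext (opComp_frameFamily_pairOp hs e g)

theorem norm_extFrameOp_apply_le {s : Finset ℕ} {φ : ℕ → G} (hs : IsBessel C s φ)
    (w : ExtTensor B C E G) : ‖extFrameOp B E hs w‖ ≤ ‖w‖ := by
  refine (OpModule.norm_compL_apply_le _ _ w).trans ?_
  exact (mul_le_mul_of_nonneg_right (norm_frameFamily_le hs) (norm_nonneg _)).trans_eq (one_mul _)

/-- On elementary tensors this is the reconstruction formula in the second factor. The operators are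
contractions, so the set of vectors where convergence holds is a closed subspace. -/
theorem tendsto_extFrameOp {s : ℕ → Finset ℕ} {φ : ℕ → G} (hs : ∀ n, IsBessel C (s n) φ)
    (hφ : ∀ g : G, Tendsto (fun n => ∑ k ∈ s n, φ k <• ip (B := C) (φ k) g) atTop (𝓝 g))
    (w : ExtTensor B C E G) : Tendsto (fun n => extFrameOp B E (hs n) w) atTop (𝓝 w) := by
  let K : Submodule ℂ (ExtTensor B C E G) :=
    { carrier := {w | Tendsto (fun n => extFrameOp B E (hs n) w) atTop (𝓝 w)}
      add_mem' := fun {w w'} h h' => by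
        simpa only [Set.mem_ofPred_eq, map_add] using h.add h'
      zero_mem' := by simp
      smul_mem' := fun c w h => by
        simpa only [Set.mem_ofPred_eq, map_smul] using h.const_smul c }
  refine ExtTensor.mem_of_isClosed K ?_ (fun e g => ?_) w
  · refine isClosed_of_closure_subset fun w hw => ?_
    refine Metric.tendsto_atTop.2 fun ε hε => ?_
    obtain ⟨w', hw', hd⟩ := Metric.mem_closure_iff.1 hw (ε / 3) (by positivity)
    obtain ⟨M, hM⟩ := Metric.tendsto_atTop.1 hw' (ε / 3) (by positivity)
    refine ⟨M, fun n hn => ?_⟩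
    have h1 : dist (extFrameOp B E (hs n) w) (extFrameOp B E (hs n) w') < ε / 3 := by
      rw [dist_eq_norm, ← map_sub]
      exact (norm_extFrameOp_apply_le _ _).trans_lt (by rwa [← dist_eq_norm])
    have h2 := hM n hn
    have h3 := dist_triangle4 (extFrameOp B E (hs n) w) (extFrameOp B E (hs n) w') w' w
    rw [dist_comm w' w] at h3
    linarith
  · change Tendsto _ _ _
    simp only [extFrameOp_extTmul]
    exact ((extTmulL B C E G e).continuous.tendsto _).comp (hφ g)

end ExteriorTensor

/-! ### Kernels of the form `⟨v | a w⟩` -/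

section Kernel

variable {A D H : Type*} [CStarAlgebra A] [NonUnitalCStarAlgebra D] [PartialOrder D]
  [NormedAddCommGroup H] [NormedSpace ℂ H] [SMul Dᵐᵒᵖ H] [InnerProductModule D H]

theorem LeftAction.hom_mul_apply (L : LeftAction A D H) (a a' : A) (x : H) :
    L.hom (a * a') x = L.hom a (L.hom a' x) := by
  rw [map_mul]; rfl

variable [StarOrderedRing D]

/-- The kernel `a ↦ ⟨v | a w⟩`. -/
def LeftAction.kernel (L : LeftAction A D H) (hL : ∀ a w, ‖L.hom a w‖ ≤ ‖a‖ * ‖w‖) (v w : H) :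
    A →L[ℂ] D :=
  LinearMap.mkContinuous
    { toFun := fun a => ip (B := D) v (L.hom a w)
      map_add' := fun a a' => by rw [map_add, LinearMap.add_apply, ip_add_right]
      map_smul' := fun c a => by
        rw [map_smul, LinearMap.smul_apply, ip_smul_right, RingHom.id_apply] } (‖v‖ * ‖w‖) fun a =>
    (norm_ip_le (D := D) v _).trans ((mul_le_mul_of_nonneg_left (hL a w) (norm_nonneg v)).trans_eq
      (by ring))

theorem LeftAction.kernel_apply (L : LeftAction A D H) (hL : ∀ a w, ‖L.hom a w‖ ≤ ‖a‖ * ‖w‖)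
    (v w : H) (a : A) : L.kernel hL v w a = ip v (L.hom a w) := rfl

theorem LeftAction.kernel_star_mul (L : LeftAction A D H)
    (hL : ∀ a w, ‖L.hom a w‖ ≤ ‖a‖ * ‖w‖) (v w : H) (a a' : A) :
    L.kernel hL v w (star a * a') = ip (L.hom a v) (L.hom a' w) := by
  rw [L.kernel_apply, L.hom_mul_apply, ← L.ip_hom_left]

/-- The double sum is `⟨h | h⟩` for `h = ∑ a_i v(x_i) d_i`. -/
theorem LeftAction.isCPKernel_kernel {X : Type*} (L : LeftAction A D H)
    (hL : ∀ a w, ‖L.hom a w‖ ≤ ‖a‖ * ‖w‖) (v : X → H) :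
    IsCPKernel fun x y => L.kernel hL (v x) (v y) := by
  intro n x a d
  convert ip_self_nonneg (B := D) (∑ i, L.hom (a i) (v (x i)) <• d i) using 1
  rw [ip_sum_left]
  refine Finset.sum_congr rfl fun i _ => ?_
  rw [ip_sum_right]
  refine Finset.sum_congr rfl fun j _ => ?_
  rw [L.kernel_star_mul, ip_op_smul_left, ip_op_smul_right, mul_assoc]

end Kernel

/-! ### Boundedness of the left action and orthogonality of elementary tensors -/

section LeftActions

variable {A B C E G : Type*} [CStarAlgebra A]
  [CStarAlgebra B] [PartialOrder B] [StarOrderedRing B]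
  [CStarAlgebra C] [PartialOrder C] [StarOrderedRing C]
  [NormedAddCommGroup E] [NormedSpace ℂ E] [SMul Bᵐᵒᵖ E] [InnerProductModule B E]
  [NormedAddCommGroup G] [NormedSpace ℂ G] [SMul Cᵐᵒᵖ G] [InnerProductModule C G]

theorem norm_extAction_apply_le (ρ : LeftAction A B E) (a : A) (w : ExtTensor B C E G) :
    ‖(extAction C G ρ).hom a w‖ ≤ ‖a‖ * ‖w‖ := by
  refine (opFamily_norm_comp_le (actFamily ρ a) (OpModule.val _ _ w)).trans
    (mul_le_mul_of_nonneg_right ?_ (norm_nonneg _))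
  refine opFamily_norm_le (norm_nonneg _) fun p => (HilbertTensor.norm_map_le _ _).trans ?_
  exact (mul_le_mul (norm_act_le _ _ _) ContinuousLinearMap.norm_id_le (norm_nonneg _)
    (norm_nonneg _)).trans_eq (mul_one _)

theorem continuous_extAction_apply (ρ : LeftAction A B E) (a : A) :
    Continuous fun w : ExtTensor B C E G => (extAction C G ρ).hom a w :=
  (LinearMap.mkContinuous ((extAction C G ρ).hom a) ‖a‖ (norm_extAction_apply_le ρ a)).continuous

theorem ip_extTmul_eq_zero (e e' : E) {g g' : G} (h : ip (B := C) g g' = 0) :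
    ip (B := MinTensor B C) (extTmul B C e g) (extTmul B C e' g') = 0 := by
  rw [ip_extTmul, h]
  refine OpAlgebra.ext ?_
  have h0 := pairOp_smul_right B C (0 : ℂ) (ip (B := B) e e') (0 : C)
  rwa [zero_smul, zero_smul] at h0

end LeftActions

/-! ### Bessel's inequality and the resolution of the identity -/

section Frames

/-- The indices of the `n`-th partial sum. -/
def partialIndices (N : ℕ∞) (n : ℕ) : Finset ℕ :=
  (Finset.range n).filter fun k : ℕ => (k : ℕ∞) < N

theorem partialSum_eq {V : Type*} [AddCommMonoid V] (N : ℕ∞) (f : ℕ → V) (n : ℕ) :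
    partialSum N f n = ∑ k ∈ partialIndices N n, f k := rfl

theorem lt_of_mem_partialIndices {N : ℕ∞} {n k : ℕ} (h : k ∈ partialIndices N n) :
    (k : ℕ∞) < N := (Finset.mem_filter.1 h).2

theorem partialIndices_mono (N : ℕ∞) : Monotone (partialIndices N) := fun _ _ h =>
  Finset.filter_subset_filter _ (Finset.range_mono h)

theorem ip_sum_op_smul_ip_mono {C G : Type*} [NonUnitalCStarAlgebra C] [PartialOrder C]
    [StarOrderedRing C] [NormedAddCommGroup G] [NormedSpace ℂ G] [SMul Cᵐᵒᵖ G]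
    [InnerProductModule C G] {s t : Finset ℕ} (h : s ⊆ t) (φ : ℕ → G) (g : G) :
    ip (B := C) g (∑ k ∈ s, φ k <• ip (B := C) (φ k) g)
      ≤ ip g (∑ k ∈ t, φ k <• ip (B := C) (φ k) g) := by
  simp only [ip_sum_right, ip_op_smul_right]
  refine Finset.sum_le_sum_of_subset_of_nonneg h fun k _ _ => ?_
  rw [← star_ip]
  exact star_mul_self_nonneg _

theorem IsBessel.mono {C G : Type*} [NonUnitalCStarAlgebra C] [PartialOrder C]
    [StarOrderedRing C] [NormedAddCommGroup G] [NormedSpace ℂ G] [SMul Cᵐᵒᵖ G]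
    [InnerProductModule C G] {s t : Finset ℕ} {φ : ℕ → G} (ht : IsBessel C t φ) (h : s ⊆ t) :
    IsBessel C s φ :=
  fun g => (ip_sum_op_smul_ip_mono h φ g).trans (ht g)

/-- The sums of `⟨φ_k | g⟩* ⟨φ_k | g⟩` increase with `n` and converge to `⟨g | g⟩` by
reconstruction, so each of them lies below the limit. -/
theorem isBessel_partialIndices {C G : Type*} [NonUnitalCStarAlgebra C] [PartialOrder C]
    [StarOrderedRing C] [NormedAddCommGroup G] [NormedSpace ℂ G] [SMul Cᵐᵒᵖ G]
    [InnerProductModule C G] {N : ℕ∞} {φ : ℕ → G}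
    (hφ : ∀ g : G, SumsTo N (fun k => φ k <• ip (B := C) (φ k) g) g) (n : ℕ) :
    IsBessel C (partialIndices N n) φ := by
  intro g
  have hmono : Monotone fun n => ip (B := C) g
      (∑ k ∈ partialIndices N n, φ k <• ip (B := C) (φ k) g) := fun m n h =>
    ip_sum_op_smul_ip_mono (partialIndices_mono N h) φ g
  exact hmono.ge_of_tendsto (((ipSL C G g).continuous.tendsto _).comp (hφ g)) n

variable {B C E G X : Type*}
  [CStarAlgebra B] [PartialOrder B] [StarOrderedRing B]
  [CStarAlgebra C] [PartialOrder C] [StarOrderedRing C]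
  [NormedAddCommGroup E] [NormedSpace ℂ E] [SMul Bᵐᵒᵖ E] [InnerProductModule B E]
  [NormedAddCommGroup G] [NormedSpace ℂ G] [SMul Cᵐᵒᵖ G] [InnerProductModule C G]
  {N : ℕ∞} {F : ℕ → X → E} {φ : ℕ → G}

theorem extFrameOp_sdiff_add {s t : Finset ℕ} (h : s ⊆ t) (ht : IsBessel C t φ)
    (hs : IsBessel C s φ) (w : ExtTensor B C E G) :
    extFrameOp B E (ht.mono (Finset.sdiff_subset (s := t) (t := s))) w + extFrameOp B E hs w
      = extFrameOp B E ht w := by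
  have he : extFrameOp B E (ht.mono (Finset.sdiff_subset (s := t) (t := s))) + extFrameOp B E hs
      = extFrameOp B E ht := ExtTensor.clm_ext fun e g => by
    rw [add_apply, extFrameOp_extTmul, extFrameOp_extTmul, extFrameOp_extTmul,
      ← Finset.sum_sdiff h]
    exact ((extTmulL B C E G e).map_add _ _).symm
  exact DFunLike.congr_fun he w

variable (B C) in
/-- The finite sums `∑ F_k(y) ⊗ φ_k`. -/
def finiteState (F : ℕ → X → E) (φ : ℕ → G) (s : Finset ℕ) (y : X) : ExtTensor B C E G :=
  ∑ k ∈ s, extTmul B C (F k y) (φ k)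

/-- Right linearity moves `⟨F_l | e⟩ ⊗ ⟨φ_l | g⟩` into the second entry, where it splits over the
two factors. Only the `E`-factor then depends on `y`, in the form that biorthogonality integrates.
-/
theorem ip_mul_ip_finiteState (u : ExtTensor B C E G) (s : Finset ℕ) (y : X) (e : E) (g : G) :
    ip (B := MinTensor B C) u (finiteState B C F φ s y)
        * ip (finiteState B C F φ s y) (extTmul B C e g)
      = ∑ k ∈ s, ∑ l ∈ s, ip u (extTmul B C (F k y <• ip (B := B) (F l y) e)
          (φ k <• ip (B := C) (φ l) g)) := by
  rw [finiteState, ip_sum_right, ip_sum_left, Finset.sum_mul_sum]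
  refine Finset.sum_congr rfl fun k _ => Finset.sum_congr rfl fun l _ => ?_
  rw [ip_extTmul, ← ip_op_smul_right, extTmul_op_smul]

variable [MeasurableSpace X] {μ : Measure X}

theorem memLp_finiteState (hF : ∀ k : ℕ, (k : ℕ∞) < N → SqIntegrable B (F k) μ) {s : Finset ℕ}
    (hs : ∀ k ∈ s, (k : ℕ∞) < N) : MemLp (finiteState B C F φ s) 2 μ :=
  memLp_finsetSum _ fun k hk =>
    ((extTmulL B C E G).flip (φ k)).comp_memLp' (hF k (hs k hk)).memLp

variable [CompleteSpace E]

theorem integral_ip_mul_ip_finiteState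
    (hF : ∀ k : ℕ, (k : ℕ∞) < N → SqIntegrable B (F k) μ)
    (horth : ∀ k l : ℕ, (k : ℕ∞) < N → (l : ℕ∞) < N → ∀ e : E,
      ∫ x, F k x <• ip (B := B) (F l x) e ∂μ = if k = l then e else 0)
    {s : Finset ℕ} (hs : ∀ k ∈ s, (k : ℕ∞) < N) (u : ExtTensor B C E G) (e : E) (g : G) :
    ∫ y, ip (B := MinTensor B C) u (finiteState B C F φ s y)
        * ip (finiteState B C F φ s y) (extTmul B C e g) ∂μ
      = ip u (extTmul B C e (∑ k ∈ s, φ k <• ip (B := C) (φ k) g)) := by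
  simp only [ip_mul_ip_finiteState]
  -- The bounded map `e' ↦ ⟨u | e' ⊗ g'⟩`, through which the integral passes to `E`.
  let T (g' : G) : E →L[ℂ] MinTensor B C :=
    ipSL (MinTensor B C) (ExtTensor B C E G) u ∘L (extTmulL B C E G).flip g'
  have hi : ∀ k ∈ s, ∀ l ∈ s, Integrable (fun y => F k y <• ip (B := B) (F l y) e) μ :=
    fun k hk l hl => integrable_op_smul_ip (hF k (hs k hk)).memLp (hF l (hs l hl)).memLp e
  have hT : ∀ k ∈ s, ∀ l ∈ s, Integrable (fun y => ip (B := MinTensor B C) u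
      (extTmul B C (F k y <• ip (B := B) (F l y) e) (φ k <• ip (B := C) (φ l) g))) μ :=
    fun k hk l hl => (T (φ k <• ip (B := C) (φ l) g)).integrable_comp (hi k hk l hl)
  rw [integral_finsetSum _ fun k hk => integrable_finsetSum _ fun l hl => hT k hk l hl]
  have hsum : extTmul B C e (∑ k ∈ s, φ k <• ip (B := C) (φ k) g)
      = ∑ k ∈ s, extTmul B C e (φ k <• ip (B := C) (φ k) g) :=
    map_sum (extTmulL B C E G e) _ _
  rw [hsum, ip_sum_right]
  refine Finset.sum_congr rfl fun k hk => ?_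
  rw [integral_finsetSum _ fun l hl => hT k hk l hl]
  have hkl : ∀ l ∈ s, ∫ y, ip (B := MinTensor B C) u
      (extTmul B C (F k y <• ip (B := B) (F l y) e) (φ k <• ip (B := C) (φ l) g)) ∂μ
      = T (φ k <• ip (B := C) (φ l) g) (if k = l then e else 0) := fun l hl => by
    rw [← horth k l (hs k hk) (hs l hl) e]
    exact (T (φ k <• ip (B := C) (φ l) g)).integral_comp_comm (hi k hk l hl)
  -- Biorthogonality leaves only the diagonal terms `l = k`.
  rw [Finset.sum_congr rfl hkl, Finset.sum_eq_single_of_mem k hk fun l _ hl => by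
    rw [if_neg hl.symm, map_zero], if_pos rfl]
  rfl

variable (hF : ∀ k : ℕ, (k : ℕ∞) < N → SqIntegrable B (F k) μ)
  (horth : ∀ k l : ℕ, (k : ℕ∞) < N → (l : ℕ∞) < N → ∀ e : E,
    ∫ x, F k x <• ip (B := B) (F l x) e ∂μ = if k = l then e else 0)
include hF horth

/-- Both sides are bounded and linear in `w`, so agreement on elementary tensors suffices. -/
theorem integral_ip_mul_ip_eq_extFrameOp {s : Finset ℕ} (hs : ∀ k ∈ s, (k : ℕ∞) < N)
    (hb : IsBessel C s φ) (u w : ExtTensor B C E G) :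
    ∫ y, ip (B := MinTensor B C) u (finiteState B C F φ s y) * ip (finiteState B C F φ s y) w ∂μ
      = ip u (extFrameOp B E hb w) := by
  have h : integralIpMulIp (MinTensor B C) u (memLp_finiteState (φ := φ) hF hs)
      = ipSL (MinTensor B C) (ExtTensor B C E G) u ∘L extFrameOp B E hb :=
    ExtTensor.clm_ext fun e g => by
      rw [integralIpMulIp_apply, integral_ip_mul_ip_finiteState hF horth hs,
        ContinuousLinearMap.comp_apply, extFrameOp_extTmul, ipSL_apply]
  exact DFunLike.congr_fun h w

/-- The index sets are nested, so a difference of partial sums is again a finite state, and its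
frame operator is the difference of the frame operators. -/
theorem integral_ip_mul_ip_partial_sub {m n : ℕ} (hmn : m ≤ n)
    (hm : IsBessel C (partialIndices N m) φ) (hn : IsBessel C (partialIndices N n) φ)
    (u w : ExtTensor B C E G) :
    ∫ y, ip (B := MinTensor B C) u (finiteState B C F φ (partialIndices N n) y
          - finiteState B C F φ (partialIndices N m) y)
        * ip (finiteState B C F φ (partialIndices N n) y
          - finiteState B C F φ (partialIndices N m) y) w ∂μ
      = ip u (extFrameOp B E hn w - extFrameOp B E hm w) := by
  have hsub := partialIndices_mono N hmn
  have hst : ∀ y, finiteState B C F φ (partialIndices N n) y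
      - finiteState B C F φ (partialIndices N m) y
      = finiteState B C F φ (partialIndices N n \ partialIndices N m) y := fun y =>
    (Finset.sum_sdiff_eq_sub hsub).symm
  simp only [hst]
  rw [integral_ip_mul_ip_eq_extFrameOp hF horth
    (fun k hk => lt_of_mem_partialIndices (Finset.mem_sdiff.1 hk).1)
    (hn.mono Finset.sdiff_subset), eq_sub_of_add_eq (extFrameOp_sdiff_add hsub hn hm w)]

/-- The resolution of the identity by the coherent states. -/
theorem hasPettisIntegral_ip_mul_ip
    (hφ : ∀ g : G, SumsTo N (fun k => φ k <• ip (B := C) (φ k) g) g)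
    {v : X → ExtTensor B C E G} {u w : ExtTensor B C E G}
    (hu : ∀ y, Tendsto (fun n => ip (B := MinTensor B C)
      (finiteState B C F φ (partialIndices N n) y) u) atTop (𝓝 (ip (v y) u)))
    (hw : ∀ y, Tendsto (fun n => ip (B := MinTensor B C)
      (finiteState B C F φ (partialIndices N n) y) w) atTop (𝓝 (ip (v y) w))) :
    HasPettisIntegral (fun y => ip (B := MinTensor B C) u (v y) * ip (v y) w) μ (ip u w) := by
  have hb := isBessel_partialIndices hφ
  have hmem : ∀ n, MemLp (finiteState B C F φ (partialIndices N n)) 2 μ := fun n =>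
    memLp_finiteState hF fun k hk => lt_of_mem_partialIndices hk
  have hlim : ∀ w : ExtTensor B C E G, Tendsto (fun n => extFrameOp B E (hb n) w) atTop (𝓝 w) :=
    tendsto_extFrameOp hb hφ
  have hbound : ∀ (w : ExtTensor B C E G) n,
      ‖∫ y, star (ip (B := MinTensor B C) (finiteState B C F φ (partialIndices N n) y) w)
        * ip (finiteState B C F φ (partialIndices N n) y) w ∂μ‖ ≤ ‖w‖ * ‖w‖ := fun w n => by
    simp only [star_ip]
    rw [integral_ip_mul_ip_eq_extFrameOp hF horth (fun _ => lt_of_mem_partialIndices) (hb n)]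
    exact (norm_ip_le _ _).trans
      (mul_le_mul_of_nonneg_left (norm_extFrameOp_apply_le _ _) (norm_nonneg _))
  -- The integral equals `⟨w | P_n w - P_m w⟩`, which is small because `P_n w` converges; `‖w‖ + 1`
  -- avoids division by zero.
  have hcauchy : ∀ (w : ExtTensor B C E G), ∀ ε > 0, ∃ M, ∀ m ≥ M, ∀ n ≥ m,
      ‖∫ y, star (ip (B := MinTensor B C) (finiteState B C F φ (partialIndices N n) y) w
          - ip (finiteState B C F φ (partialIndices N m) y) w)
        * (ip (finiteState B C F φ (partialIndices N n) y) w
          - ip (finiteState B C F φ (partialIndices N m) y) w) ∂μ‖ ≤ ε := fun w ε hε => by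
    obtain ⟨M, hM⟩ := Metric.cauchySeq_iff.1 (hlim w).cauchySeq (ε / (‖w‖ + 1)) (by positivity)
    refine ⟨M, fun m hm n hn => ?_⟩
    simp only [← ip_sub_left, star_ip]
    rw [integral_ip_mul_ip_partial_sub hF horth hn (hb m) (hb n)]
    refine (norm_ip_le _ _).trans ?_
    rw [← dist_eq_norm]
    refine (mul_le_mul_of_nonneg_left (hM n (hm.trans hn) m hm).le (norm_nonneg _)).trans ?_
    rw [mul_div_assoc', div_le_iff₀ (by positivity)]
    nlinarith [norm_nonneg w]
  have hv : Tendsto (fun n => ∫ y,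
      star (ip (B := MinTensor B C) (finiteState B C F φ (partialIndices N n) y) u)
        * ip (finiteState B C F φ (partialIndices N n) y) w ∂μ) atTop (𝓝 (ip u w)) := by
    simp only [star_ip]
    simp only [integral_ip_mul_ip_eq_extFrameOp hF horth (fun _ => lt_of_mem_partialIndices) (hb _)]
    exact ((ipSL (MinTensor B C) (ExtTensor B C E G) u).continuous.tendsto _).comp (hlim w)
  have key := hasPettisIntegral_star_mul (fun n => memLp_ip_left (D := MinTensor B C) (hmem n) u)
    (fun n => memLp_ip_left (D := MinTensor B C) (hmem n) w) hu hw
    (R := max (‖u‖ * ‖u‖) (‖w‖ * ‖w‖))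
    (fun n => (hbound u n).trans (le_max_left _ _)) (fun n => (hbound w n).trans (le_max_right _ _))
    (hcauchy u) (hcauchy w) hv
  simpa only [star_ip] using key

end Frames

/-- In a unital algebra every element is of the form `1* a`. -/
theorem kernel_ext_star_mul {A D X : Type*} [CStarAlgebra A] [NonUnitalCStarAlgebra D]
    {K K' : X → X → A →L[ℂ] D}
    (h : ∀ x y a a', K' x y (star a * a') = K x y (star a * a')) : K' = K := by
  funext x y
  ext1 a
  simpa only [star_one, one_mul] using h x y 1 a

/-! ### Coherent states and their kernel -/

section CoherentStates

variable {A B C E G X : Type*} [CStarAlgebra A]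
  [CStarAlgebra B] [PartialOrder B] [StarOrderedRing B]
  [CStarAlgebra C] [PartialOrder C] [StarOrderedRing C]
  [NormedAddCommGroup E] [NormedSpace ℂ E] [SMul Bᵐᵒᵖ E] [InnerProductModule B E]
  [NormedAddCommGroup G] [NormedSpace ℂ G] [SMul Cᵐᵒᵖ G] [InnerProductModule C G]
  (ρ : LeftAction A B E) {N : ℕ∞} {F : ℕ → X → E} {φ : ℕ → G}

theorem extAction_partialSum (x : X) (a a' : A) (n : ℕ) :
    (extAction C G ρ).hom a (partialSum N (fun k => extTmul B C (ρ.hom a' (F k x)) (φ k)) n)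
      = partialSum N (fun k => extTmul B C (ρ.hom (a * a') (F k x)) (φ k)) n := by
  rw [partialSum_eq, partialSum_eq, map_sum]
  refine Finset.sum_congr rfl fun k _ => ?_
  rw [extAction_extTmul, ← LeftAction.hom_mul_apply]

theorem extAction_finiteState (y : X) (a : A) (n : ℕ) :
    (extAction C G ρ).hom a (finiteState B C F φ (partialIndices N n) y)
      = partialSum N (fun k => extTmul B C (ρ.hom a (F k y)) (φ k)) n := by
  rw [partialSum_eq, finiteState, map_sum]
  refine Finset.sum_congr rfl fun k _ => ?_
  rw [extAction_extTmul]

theorem sumsTo_extAction {x : X} {v : ExtTensor B C E G}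
    (hv : SumsTo N (fun k => extTmul B C (ρ.hom 1 (F k x)) (φ k)) v) (a : A) :
    SumsTo N (fun k => extTmul B C (ρ.hom a (F k x)) (φ k)) ((extAction C G ρ).hom a v) := by
  refine (((continuous_extAction_apply (C := C) (G := G) ρ a).tendsto v).comp hv).congr fun n => ?_
  rw [Function.comp_apply, extAction_partialSum, mul_one]

/-- The kernel `⟨k_x | a k_y⟩`. -/
def stateKernel (k : X → ExtTensor B C E G) (x y : X) : A →L[ℂ] MinTensor B C :=
  (extAction C G ρ).kernel (norm_extAction_apply_le ρ) (k x) (k y)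

theorem stateKernel_apply (k : X → ExtTensor B C E G) (x y : X) (a : A) :
    stateKernel ρ k x y a = ip (k x) ((extAction C G ρ).hom a (k y)) := rfl

theorem stateKernel_star_mul (k : X → ExtTensor B C E G) (x y : X) (a a' : A) :
    stateKernel ρ k x y (star a * a')
      = ip ((extAction C G ρ).hom a (k x)) ((extAction C G ρ).hom a' (k y)) :=
  LeftAction.kernel_star_mul _ _ _ _ a a'

theorem isCPKernel_stateKernel (k : X → ExtTensor B C E G) : IsCPKernel (stateKernel ρ k) :=
  LeftAction.isCPKernel_kernel _ _ _

theorem isKolmogorovDecomposition_stateKernel (k : X → ExtTensor B C E G) :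
    IsKolmogorovDecomposition (extAction C G ρ) k (stateKernel ρ k) :=
  stateKernel_apply ρ k

/-- The left action need not be unital, so the sums `∑ F_k(y) ⊗ φ_k` themselves need not converge;
only their images under elements of `A` do. Paired with a vector `a w`, the operator `a` moves to
the other side as `a*` and produces such an image. -/
theorem tendsto_ip_finiteState {k : X → ExtTensor B C E G}
    (hk : ∀ y a, SumsTo N (fun j => extTmul B C (ρ.hom a (F j y)) (φ j))
      ((extAction C G ρ).hom a (k y))) (a : A) (w : ExtTensor B C E G) (y : X) :
    Tendsto (fun n => ip (B := MinTensor B C) (finiteState B C F φ (partialIndices N n) y)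
      ((extAction C G ρ).hom a w)) atTop (𝓝 (ip (k y) ((extAction C G ρ).hom a w))) := by
  have hmove : ∀ w' : ExtTensor B C E G, ip (B := MinTensor B C) w' ((extAction C G ρ).hom a w)
      = ip ((extAction C G ρ).hom (star a) w') w := fun w' => by
    rw [LeftAction.ip_hom_left, star_star]
  simp only [hmove, extAction_finiteState]
  have hc : Continuous fun w' : ExtTensor B C E G => ip (B := MinTensor B C) w' w :=
    continuous_ip.comp (Continuous.prodMk continuous_id continuous_const)
  exact (hc.tendsto _).comp (hk y (star a))

theorem hasPettisIntegral_stateKernel [CompleteSpace E] [MeasurableSpace X] {μ : Measure X}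
    (hF : ∀ k : ℕ, (k : ℕ∞) < N → SqIntegrable B (F k) μ)
    (horth : ∀ k l : ℕ, (k : ℕ∞) < N → (l : ℕ∞) < N → ∀ e : E,
      ∫ x, F k x <• ip (B := B) (F l x) e ∂μ = if k = l then e else 0)
    (hφ : ∀ g : G, SumsTo N (fun k => φ k <• ip (B := C) (φ k) g) g)
    {k : X → ExtTensor B C E G}
    (hk : ∀ y a, SumsTo N (fun j => extTmul B C (ρ.hom a (F j y)) (φ j))
      ((extAction C G ρ).hom a (k y))) (x z : X) (a a' b : A) (hb : b * star b = 1) :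
    HasPettisIntegral (fun y => stateKernel ρ k x y (star a * b) * stateKernel ρ k y z (star b * a'))
      μ (stateKernel ρ k x z (star a * a')) := by
  -- The factors `b` are moved away from the integration point `y`, onto the fixed vectors `b* a
  -- k_x` and `b* a' k_z`; in their inner product `b b* = 1` cancels.
  have h := hasPettisIntegral_ip_mul_ip hF horth hφ
    (tendsto_ip_finiteState ρ hk (star b * a) (k x))
    (tendsto_ip_finiteState ρ hk (star b * a') (k z))
  have e1 : ip (B := MinTensor B C) ((extAction C G ρ).hom (star b * a) (k x))
      ((extAction C G ρ).hom (star b * a') (k z)) = stateKernel ρ k x z (star a * a') := by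
    rw [← stateKernel_star_mul, star_mul, star_star, mul_assoc, ← mul_assoc b, hb, one_mul]
  have e2 : ∀ y, ip (B := MinTensor B C) ((extAction C G ρ).hom (star b * a) (k x)) (k y)
      = stateKernel ρ k x y (star a * b) := fun y => by
    rw [LeftAction.ip_hom_left, star_mul, star_star, stateKernel_apply]
  rw [e1] at h
  simp only [e2] at h
  exact h

/-- The inner product of two `n`-th partial sums is a double sum whose off-diagonal terms vanish, so
it is already the `n`-th partial sum of the diagonal series; continuity of the inner product gives
the limit. -/
theorem sumsTo_ip_of_orthogonal
    (horthφ : ∀ k l : ℕ, (k : ℕ∞) < N → (l : ℕ∞) < N → k ≠ l → ip (B := C) (φ k) (φ l) = 0)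
    {e e' : ℕ → E} {v w : ExtTensor B C E G}
    (hv : SumsTo N (fun k => extTmul B C (e k) (φ k)) v)
    (hw : SumsTo N (fun k => extTmul B C (e' k) (φ k)) w) :
    SumsTo N (fun k => ip (B := MinTensor B C) (extTmul B C (e k) (φ k))
      (extTmul B C (e' k) (φ k))) (ip v w) := by
  refine (((continuous_ip (D := MinTensor B C)).tendsto (v, w)).comp
    (hv.prodMk_nhds hw)).congr fun n => ?_
  rw [Function.comp_apply, partialSum_eq, partialSum_eq, partialSum_eq, ip_sum_left]
  refine Finset.sum_congr rfl fun k hk => ?_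
  rw [ip_sum_right, Finset.sum_eq_single_of_mem k hk fun l hl hne => ip_extTmul_eq_zero _ _
    (horthφ k l (lt_of_mem_partialIndices hk) (lt_of_mem_partialIndices hl) hne.symm)]

end CoherentStates


end

/-! ### The main theorem -/

theorem mainTheorem2 {A B C E G X : Type*} [CStarAlgebra A]
    [CStarAlgebra B] [PartialOrder B] [StarOrderedRing B]
    [CStarAlgebra C] [PartialOrder C] [StarOrderedRing C]
    [NormedAddCommGroup E] [NormedSpace ℂ E] [CompleteSpace E] [SMul Bᵐᵒᵖ E]
    [InnerProductModule B E]
    [NormedAddCommGroup G] [NormedSpace ℂ G] [CompleteSpace G] [SMul Cᵐᵒᵖ G]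
    [InnerProductModule C G]
    (ρ : LeftAction A B E) [MeasurableSpace X] (μ : Measure X) [IsFiniteMeasure μ]
    (N : ℕ∞) (F : ℕ → X → E) (φ : ℕ → G)
    (hF : ∀ k : ℕ, (k : ℕ∞) < N → SqIntegrable B (F k) μ)
    (horth : ∀ k l : ℕ, (k : ℕ∞) < N → (l : ℕ∞) < N → ∀ e : E,
      ∫ x, F k x <• ip (B := B) (F l x) e ∂μ = if k = l then e else 0)
    (hφ : ∀ g : G, SumsTo N (fun k => φ k <• ip (B := C) (φ k) g) g)
    (hconv : ∀ (x : X) (a : A), a * star a = 1 →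
      ∃ v : ExtTensor B C E G, SumsTo N (fun k => extTmul B C (ρ.hom a (F k x)) (φ k)) v) :
    (∀ (x : X) (a : A),
      SumsTo N (fun k => extTmul B C (ρ.hom a (F k x)) (φ k)) (mvcs C ρ N F φ x a)) ∧
    ∃ K : X → X → A →L[ℂ] MinTensor B C,
      (∀ (x y : X) (a a' : A),
        K x y (star a * a') = ip (mvcs C ρ N F φ x a) (mvcs C ρ N F φ y a')) ∧
      (∀ K' : X → X → A →L[ℂ] MinTensor B C,
        (∀ (x y : X) (a a' : A),
          K' x y (star a * a') = ip (mvcs C ρ N F φ x a) (mvcs C ρ N F φ y a')) →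
        K' = K) ∧
      ((∀ k l : ℕ, (k : ℕ∞) < N → (l : ℕ∞) < N → k ≠ l → ip (B := C) (φ k) (φ l) = 0) →
        ∀ (x y : X) (a a' : A), SumsTo N
          (fun k => ip (B := MinTensor B C) (extTmul B C (ρ.hom a (F k x)) (φ k))
            (extTmul B C (ρ.hom a' (F k y)) (φ k)))
          (K x y (star a * a'))) ∧
      IsCPKernel K ∧
      (∀ (x : X) (a : A), mvcs C ρ N F φ x a = (extAction C G ρ).hom a (mvcs C ρ N F φ x 1)) ∧
      IsKolmogorovDecomposition (extAction C G ρ) (fun x => mvcs C ρ N F φ x 1) K ∧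
      (∀ (x z : X) (a a' b : A), b * star b = 1 →
        HasPettisIntegral (fun y => K x y (star a * b) * K y z (star b * a')) μ
          (K x z (star a * a'))) ∧
      (∀ (x z : X) (a' : A), HasPettisIntegral (fun y => K x y 1 * K y z a') μ (K x z a')) := by
  -- The unit is admissible, as `1 1* = 1`, and acting by `a` on this one limit yields every other
  -- series.
  choose v hv using fun x => hconv x 1 (by simp)
  have hmv : ∀ x a, mvcs C ρ N F φ x a = (extAction C G ρ).hom a (v x) := fun x a =>
    (sumsTo_extAction ρ (hv x) a).limUnder_eq
  -- From `a = a 1`; that `1` acts as the identity is not needed.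
  have hact : ∀ x a, mvcs C ρ N F φ x a = (extAction C G ρ).hom a (mvcs C ρ N F φ x 1) :=
    fun x a => by rw [hmv, hmv, ← LeftAction.hom_mul_apply, mul_one]
  have hsum : ∀ x a, SumsTo N (fun k => extTmul B C (ρ.hom a (F k x)) (φ k))
      (mvcs C ρ N F φ x a) := fun x a => by
    rw [hmv]
    exact sumsTo_extAction ρ (hv x) a
  have hK : ∀ x y a a', stateKernel ρ (fun x => mvcs C ρ N F φ x 1) x y (star a * a')
      = ip (mvcs C ρ N F φ x a) (mvcs C ρ N F φ y a') := fun x y a a' =>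
    (stateKernel_star_mul ρ _ x y a a').trans (congrArg₂ ip (hact x a).symm (hact y a').symm)
  have hint := hasPettisIntegral_stateKernel ρ hF horth hφ
    (k := fun x => mvcs C ρ N F φ x 1) fun x a => hact x a ▸ hsum x a
  refine ⟨hsum, stateKernel ρ fun x => mvcs C ρ N F φ x 1, hK, fun K' hK' => ?_,
    fun horthφ x y a a' => ?_, isCPKernel_stateKernel ρ _, hact,
    isKolmogorovDecomposition_stateKernel ρ _, hint, fun x z a' => ?_⟩
  · exact kernel_ext_star_mul fun x y a a' => (hK' x y a a').trans (hK x y a a').symm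
  · exact hK x y a a' ▸ sumsTo_ip_of_orthogonal horthφ (hsum x a) (hsum y a')
  · simpa only [star_one, one_mul] using hint x z 1 a' 1 (by simp)
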